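/- Let $\mathfrak{so}_5=\{X\in M_5(\mathbb{C}) : X^{\mathsf T}=-X\}$ be the complex orthogonal Lie algebra with bracket $[X,Y]=XY-YX$, and let $T_{\mathfrak{so}_5}\in\mathfrak{so}_5^*\otimes\mathfrak{so}_5^*\otimes\mathfrak{so}_5$ be its structure tensor, i.e. the tensor corresponding to the bilinear map $(X,Y)\mapsto[X,Y]$; in a basis $(a_i)$ with dual basis $(\alpha^i)$ and $[a_i,a_j]=\sum_k A_{ij}^k a_k$, it is $T_{\mathfrak{so}_5}=\sum_{i,j,k}A_{ij}^k\,\alpha^i\otimes\alpha^j\otimes a_k$. For finite-dimensional complex vector spaces $A,B,C$, the rank of $T\in A\otimes B\otimes C$ is the least $r$ such that $T$ is a sum of $r$ tensors of the form $a\otimes b\otimes c$, and the border rank $\underline{\mathbf R}(T)$ is the least $r$ such that $T=\lim_{\varepsilon\to0^+}T_\varepsilon$ for some family $(T_\varepsilon)_{\varepsilon>0}$ of tensors of rank $r$. Then $$\underline{\mathbf R}(T_{\mathfrak{so}_5})\ge 19 .$$ -/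

import Mathlib

open scoped TensorProduct Topology

section TensorRank

variable {A B C : Type*} [AddCommGroup A] [Module ℂ A] [AddCommGroup B] [Module ℂ B]
  [AddCommGroup C] [Module ℂ C]

/-- The rank of a tensor `T ∈ A ⊗ B ⊗ C`: the least `r` such that
`T = ∑ i < r, a i ⊗ b i ⊗ c i`. -/
noncomputable def tensorRank (T : A ⊗[ℂ] (B ⊗[ℂ] C)) : ℕ :=
  sInf {r : ℕ | ∃ (a : Fin r → A) (b : Fin r → B) (c : Fin r → C),
    T = ∑ i, a i ⊗ₜ[ℂ] (b i ⊗ₜ[ℂ] c i)}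

/-- `T` is the limit as `ε → 0⁺` of a family `S ε` of tensors. The limit is taken in the canonical
vector space topology on `A ⊗ B ⊗ C`, which for finite-dimensional spaces is the usual
(Euclidean) one. -/
def IsTensorLimit (S : ℝ → A ⊗[ℂ] (B ⊗[ℂ] C)) (T : A ⊗[ℂ] (B ⊗[ℂ] C)) : Prop :=
  letI : TopologicalSpace (A ⊗[ℂ] (B ⊗[ℂ] C)) := moduleTopology ℂ (A ⊗[ℂ] (B ⊗[ℂ] C))
  Filter.Tendsto S (𝓝[>] (0 : ℝ)) (𝓝 T)

/-- The border rank of a tensor `T ∈ A ⊗ B ⊗ C` (for finite-dimensional complex vector spaces):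
the least `r` such that `T` is a limit of tensors of rank `r`. -/
noncomputable def borderRank (T : A ⊗[ℂ] (B ⊗[ℂ] C)) : ℕ :=
  sInf {r : ℕ | ∃ S : ℝ → A ⊗[ℂ] (B ⊗[ℂ] C),
    (∀ ε : ℝ, 0 < ε → tensorRank (S ε) = r) ∧ IsTensorLimit S T}

end TensorRank

section StructureTensor

variable (L : Type*) [LieRing L] [LieAlgebra ℂ L] [Module.Finite ℂ L]

/-- The structure tensor of a finite-dimensional complex Lie algebra `L`: the Lie bracket
`L → L → L`, regarded as an element of `L* ⊗ L* ⊗ L` through the canonical isomorphisms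
`V* ⊗ W ≃ Hom(V, W)`. -/
noncomputable def structureTensor :
    Module.Dual ℂ L ⊗[ℂ] (Module.Dual ℂ L ⊗[ℂ] L) :=
  (dualTensorHomEquiv ℂ L (Module.Dual ℂ L ⊗[ℂ] L)).symm
    ((dualTensorHomEquiv ℂ L L).symm.toLinearMap ∘ₗ
      LinearMap.mk₂ ℂ (fun x y : L => ⁅x, y⁆) add_lie smul_lie lie_add
        (fun c x y => lie_smul c x y))

/-- The structure tensor in terms of a basis `b` with dual basis `b.coord`:
`∑ i j k, A i j k • (b.coord i ⊗ b.coord j ⊗ b k)`, where `A i j k` is the coefficient of `b k` in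
`⁅b i, b j⁆`. -/
theorem structureTensor_eq_sum {ι : Type*} [Fintype ι] (b : Module.Basis ι ℂ L) :
    structureTensor L = ∑ i, ∑ j, ∑ k,
      b.repr ⁅b i, b j⁆ k • (b.coord i ⊗ₜ[ℂ] (b.coord j ⊗ₜ[ℂ] b k)) := by
  classical
  have h : ∀ i, ∑ j, ∑ k, b.repr ⁅b i, b j⁆ k • (b.coord i ⊗ₜ[ℂ] (b.coord j ⊗ₜ[ℂ] b k)) =
      b.coord i ⊗ₜ[ℂ] ∑ j, b.coord j ⊗ₜ[ℂ] ⁅b i, b j⁆ := by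
    intro i
    rw [TensorProduct.tmul_sum]
    refine Finset.sum_congr rfl fun j _ => ?_
    simp_rw [← TensorProduct.tmul_smul, ← TensorProduct.tmul_sum, b.sum_repr]
  simp_rw [h]
  rw [structureTensor, LinearEquiv.symm_apply_eq]
  refine b.ext fun m => ?_
  simp only [LinearMap.comp_apply, LinearEquiv.coe_coe, LinearEquiv.symm_apply_eq]
  refine b.ext fun n => ?_
  simp [dualTensorHomEquiv, dualTensorHom_apply, LinearMap.sum_apply, map_sum,
    Finsupp.single_apply, ite_smul]

end StructureTensor

/-!
A tensor that is a limit of sums of eighteen rank-one tensors `a ⊗ b ⊗ c` loses two of the eighteen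
terms in the quotient of its third factor by two of the vectors `c`. If a further projection brings
the third factor down to `ℂ⁷`, then the Koszul flattening
`ℂ¹⁰ ⊗ Λ³ℂ⁷ → ℂ¹⁰ ⊗ Λ⁴ℂ⁷` of what is left has rank at most `16 * 20 = 320`, since a rank-one term
contributes at most `(6 choose 3) = 20` (`koszulRank_sum_le`). By lower semicontinuity of the rank
and compactness of the sphere there is then a plane in `so₅` such that every projection of the
structure tensor to `ℂ⁷` that kills this plane has Koszul rank at most `320`; this condition on a
plane is `KoszulBound`.

The condition is closed (`koszulBound_of_tendsto`) and invariant under the orthogonal group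
(`KoszulBound.skewAct`). As in the proof of the Borel fixed point theorem, it must therefore hold
for the plane that is stable under a Borel subgroup, which is spanned by the two highest root
vectors. This is made explicit in `false_of_koszulBound`: some isometry gives a vector of the plane
a nonzero highest root coordinate, so that a one-parameter torus moves it to the highest root vector
in the limit; then an isometry that preserves the line of the highest root vector, followed by the
torus again, moves the plane to the one spanned by the two highest root vectors.

For this plane one explicit projection leaves a tensor of Koszul rank at least `321`
(`le_koszulRank_of_bracketTable`, `not_koszulBound_splitTensor`). Here the Koszul flattening is a
sparse integer matrix with `350` rows, and a verified Gaussian elimination (`elimCount_le_finrank`)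
bounds its rank from below.

All computations take place in coordinates in which the quadratic form is split. There `so₅` is the
space of skew-symmetric matrices with the bracket `Y J Z - Z J Y`, where `J` is the matrix of the
form, and the coordinate vectors `e_0, …, e_9` are root vectors and a basis of a Cartan subalgebra,
with `e_0` and `e_1` of the two highest roots.
-/

open scoped Matrix
open Filter Module

/-! ### Gaussian elimination on sparse integer rows -/

/-- The coefficient at position `c` of a sparse row, a list of pairs `(position, value)` in which
positions may repeat. This function and those below are written with recursors, which the kernel
evaluates faster than compiled pattern matching. -/
noncomputable def rowCoeff (c : ℕ) (r : List (ℕ × ℤ)) : ℤ :=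
  r.rec 0 (fun e _ ih => bif Nat.beq e.1 c then e.2 + ih else ih)

/-- Adds the value `x` at position `c` to a sparse row, dropping an entry that cancels. -/
noncomputable def addEntry (c : ℕ) (x : ℤ) (r : List (ℕ × ℤ)) : List (ℕ × ℤ) :=
  r.rec [(c, x)] fun e r ih =>
    bif Nat.beq e.1 c then (bif e.2 + x == 0 then r else (c, e.2 + x) :: r) else e :: ih

/-- The sparse row `a • r + b • p`. -/
noncomputable def combineRows (a b : ℤ) (r p : List (ℕ × ℤ)) : List (ℕ × ℤ) :=
  p.rec (r.rec [] fun e _ ih => (e.1, a * e.2) :: ih) (fun e _ s => addEntry e.1 (b * e.2) s)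

/-- Clears position `c` of the row `r` by the pivot row `p`, whose coefficient at `c` is `a`. -/
noncomputable def reduceRow (c : ℕ) (a : ℤ) (p r : List (ℕ × ℤ)) : List (ℕ × ℤ) :=
  bif rowCoeff c r == 0 then r else combineRows a (-rowCoeff c r) r p

/-- `reduceRow` on every row of a list. -/
noncomputable def reduceRows (c : ℕ) (a : ℤ) (p : List (ℕ × ℤ)) (rs : List (List (ℕ × ℤ))) :
    List (List (ℕ × ℤ)) :=
  rs.rec [] fun r _ ih => reduceRow c a p r :: ih

/-- The number of pivots that fraction-free Gaussian elimination finds in the first `n` of the given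
rows, the pivot of a row being at the position of its first entry. -/
noncomputable def elimCount (n : ℕ) : List (List (ℕ × ℤ)) → ℕ :=
  n.rec (fun _ => 0) fun _ ih rs => rs.rec 0 fun r rs _ => r.rec (ih rs) fun e p _ =>
    bif rowCoeff e.1 (e :: p) == 0 then ih rs
    else ih (reduceRows e.1 (rowCoeff e.1 (e :: p)) (e :: p) rs) + 1

/-- The vector that a sparse row stands for. -/
def rowVec (r : List (ℕ × ℤ)) : ℕ → ℂ :=
  (r.map fun e => Pi.single e.1 (e.2 : ℂ)).sum

@[simp] lemma rowVec_nil : rowVec [] = 0 := rfl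

@[simp] lemma rowVec_cons (e : ℕ × ℤ) (r : List (ℕ × ℤ)) :
    rowVec (e :: r) = Pi.single e.1 (e.2 : ℂ) + rowVec r := by
  simp [rowVec]

lemma rowVec_append (r s : List (ℕ × ℤ)) : rowVec (r ++ s) = rowVec r + rowVec s := by
  simp [rowVec]

lemma rowCoeff_cons (c : ℕ) (e : ℕ × ℤ) (r : List (ℕ × ℤ)) :
    rowCoeff c (e :: r) = if e.1 = c then e.2 + rowCoeff c r else rowCoeff c r := by
  change cond (Nat.beq e.1 c) (e.2 + rowCoeff c r) (rowCoeff c r) = _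
  by_cases h : e.1 = c
  · simp [h]
  · have h' : Nat.beq e.1 c = false := by
      rw [← Bool.not_eq_true, Nat.beq_eq]; exact h
    simp [h, h']

lemma rowVec_apply (c : ℕ) (r : List (ℕ × ℤ)) : rowVec r c = rowCoeff c r := by
  induction r with
  | nil => simp [rowCoeff]
  | cons e r ih =>
    rw [rowVec_cons, Pi.add_apply, ih, rowCoeff_cons]
    by_cases h : e.1 = c
    · subst h; simp
    · simp [h, Ne.symm h]

lemma rowVec_addEntry (c : ℕ) (x : ℤ) (r : List (ℕ × ℤ)) :
    rowVec (addEntry c x r) = Pi.single c (x : ℂ) + rowVec r := by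
  induction r with
  | nil => simp [addEntry]
  | cons e r ih =>
    change rowVec (cond (Nat.beq e.1 c) (cond (e.2 + x == 0) r ((c, e.2 + x) :: r))
      (e :: addEntry c x r)) = _
    by_cases h : e.1 = c
    · subst h
      have hs : Pi.single e.1 (x : ℂ) + (Pi.single e.1 (e.2 : ℂ) + rowVec r)
          = Pi.single e.1 ((e.2 + x : ℤ) : ℂ) + rowVec r := by
        rw [← add_assoc, ← Pi.single_add]; push_cast; rw [add_comm (x : ℂ)]
      by_cases h0 : e.2 + x = 0
      · simp [hs, h0]
      · have h0' : (e.2 + x == 0) = false := by simpa using h0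
        simp only [Nat.beq_refl, h0', cond_true, cond_false, rowVec_cons, hs]
    · have h' : Nat.beq e.1 c = false := by
        rw [← Bool.not_eq_true, Nat.beq_eq]; exact h
      rw [h', cond_false, rowVec_cons, ih, rowVec_cons, add_left_comm]

lemma rowVec_combineRows (a b : ℤ) (r p : List (ℕ × ℤ)) :
    rowVec (combineRows a b r p) = (a : ℂ) • rowVec r + (b : ℂ) • rowVec p := by
  induction p with
  | nil =>
    simp only [rowVec_nil, smul_zero, add_zero]
    induction r with
    | nil => simp [combineRows]
    | cons e r ih =>
      change rowVec ((e.1, a * e.2) :: combineRows a b r []) = _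
      rw [rowVec_cons, ih, rowVec_cons, smul_add, ← Pi.single_smul]
      simp
  | cons e p ih =>
    change rowVec (addEntry e.1 (b * e.2) (combineRows a b r p)) = _
    rw [rowVec_addEntry, ih, rowVec_cons, smul_add, ← Pi.single_smul, add_left_comm]
    simp

lemma rowVec_reduceRow_apply_self {c : ℕ} {p : List (ℕ × ℤ)} (r : List (ℕ × ℤ)) :
    rowVec (reduceRow c (rowCoeff c p) p r) c = 0 := by
  rw [reduceRow]
  by_cases h : rowCoeff c r = 0
  · simp [h, rowVec_apply]
  · have h' : (rowCoeff c r == 0) = false := by simpa using h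
    rw [h', cond_false, rowVec_combineRows]
    simp only [Pi.add_apply, Pi.smul_apply, rowVec_apply, smul_eq_mul]
    push_cast
    ring

lemma rowVec_reduceRow_mem (c : ℕ) (a : ℤ) {p r : List (ℕ × ℤ)} {U : Submodule ℂ (ℕ → ℂ)}
    (hp : rowVec p ∈ U) (hr : rowVec r ∈ U) : rowVec (reduceRow c a p r) ∈ U := by
  rw [reduceRow]
  cases rowCoeff c r == 0
  · rw [cond_false, rowVec_combineRows]
    exact U.add_mem (U.smul_mem _ hr) (U.smul_mem _ hp)
  · exact hr

lemma reduceRows_eq_map (c : ℕ) (a : ℤ) (p : List (ℕ × ℤ)) (rs : List (List (ℕ × ℤ))) :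
    reduceRows c a p rs = rs.map (reduceRow c a p) := by
  induction rs with
  | nil => rfl
  | cons r rs ih => rw [List.map_cons, ← ih]; rfl

/-- The row space of a list of sparse rows. -/
def rowSpace (rs : List (List (ℕ × ℤ))) : Submodule ℂ (ℕ → ℂ) :=
  Submodule.span ℂ (rowVec '' {r | r ∈ rs})

instance (rs : List (List (ℕ × ℤ))) : FiniteDimensional ℂ (rowSpace rs) :=
  FiniteDimensional.span_of_finite ℂ ((List.finite_toSet rs).image _)

lemma rowVec_mem_rowSpace {r : List (ℕ × ℤ)} {rs : List (List (ℕ × ℤ))} (h : r ∈ rs) :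
    rowVec r ∈ rowSpace rs :=
  Submodule.subset_span ⟨r, h, rfl⟩

lemma rowSpace_le_iff {rs : List (List (ℕ × ℤ))} {U : Submodule ℂ (ℕ → ℂ)} :
    rowSpace rs ≤ U ↔ ∀ r ∈ rs, rowVec r ∈ U := by
  simp [rowSpace, Submodule.span_le, Set.subset_def]

lemma rowSpace_le_cons (r : List (ℕ × ℤ)) (rs : List (List (ℕ × ℤ))) :
    rowSpace rs ≤ rowSpace (r :: rs) :=
  rowSpace_le_iff.2 fun _ h => rowVec_mem_rowSpace (List.mem_cons_of_mem _ h)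

/-- Gaussian elimination never finds more pivots than the rank. -/
theorem elimCount_le_finrank (n : ℕ) (rs : List (List (ℕ × ℤ))) :
    elimCount n rs ≤ Module.finrank ℂ (rowSpace rs) := by
  induction n generalizing rs with
  | zero => exact Nat.zero_le _
  | succ n ih =>
    match rs with
    | [] => exact Nat.zero_le _
    | [] :: rs => exact (ih rs).trans (Submodule.finrank_mono (rowSpace_le_cons _ _))
    | (e :: p) :: rs =>
      change cond (rowCoeff e.1 (e :: p) == 0) (elimCount n rs)
        (elimCount n (reduceRows e.1 (rowCoeff e.1 (e :: p)) (e :: p) rs) + 1) ≤ _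
      by_cases h : rowCoeff e.1 (e :: p) = 0
      · rw [h]
        exact (ih rs).trans (Submodule.finrank_mono (rowSpace_le_cons _ _))
      · have h' : (rowCoeff e.1 (e :: p) == 0) = false := by simpa using h
        rw [h', cond_false, reduceRows_eq_map]
        refine (Nat.succ_le_succ (ih _)).trans (Submodule.finrank_lt_finrank_of_lt ?_)
        -- The reduced rows vanish at the pivot position, the pivot row does not.
        refine lt_of_le_of_ne (rowSpace_le_iff.2 ?_) fun heq => ?_
        · simp only [List.mem_map, forall_exists_index, and_imp, forall_apply_eq_imp_iff₂]
          exact fun r hr => rowVec_reduceRow_mem _ _ (rowVec_mem_rowSpace List.mem_cons_self)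
            (rowVec_mem_rowSpace (List.mem_cons_of_mem _ hr))
        · have hle : rowSpace (rs.map (reduceRow e.1 (rowCoeff e.1 (e :: p)) (e :: p))) ≤
              LinearMap.ker (LinearMap.proj (R := ℂ) (φ := fun _ : ℕ => ℂ) e.1) := by
            refine rowSpace_le_iff.2 ?_
            simp only [List.mem_map, forall_exists_index, and_imp, forall_apply_eq_imp_iff₂]
            exact fun r _ => rowVec_reduceRow_apply_self r
          rw [heq] at hle
          have h0 : rowVec (e :: p) e.1 = 0 := hle (rowVec_mem_rowSpace List.mem_cons_self)
          rw [rowVec_apply] at h0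
          exact h (by exact_mod_cast h0)

/-! ### The Koszul flattening -/

/-- The coordinate of `u ∧ w 0 ∧ w 1 ∧ w 2`, for vectors of `ℂ⁷`, that belongs to the coordinates
`U` of `ℂ⁷`: the minor in the columns `U` of the matrix with the rows `u, w 0, w 1, w 2`. -/
noncomputable def wedge (u : Fin 7 → ℂ) (w : Fin 3 → Fin 7 → ℂ) (U : Fin 4 → Fin 7) : ℂ :=
  Matrix.det (Matrix.of fun a b => (Matrix.vecCons u w : Fin 4 → Fin 7 → ℂ) a (U b))

lemma wedge_eq_det_updateRow (u : Fin 7 → ℂ) (w : Fin 3 → Fin 7 → ℂ) (U : Fin 4 → Fin 7) :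
    wedge u w U = Matrix.det (Matrix.updateRow
      (Matrix.of fun a b => (Matrix.vecCons 0 w : Fin 4 → Fin 7 → ℂ) a (U b)) 0 (u ∘ U)) := by
  rw [wedge]
  congr 1
  ext a b
  refine Fin.cases ?_ (fun a => ?_) a <;> simp [Matrix.updateRow_apply]

/-- `wedge` as a linear function of its first argument. -/
noncomputable def wedgeLinear (w : Fin 3 → Fin 7 → ℂ) (U : Fin 4 → Fin 7) :
    (Fin 7 → ℂ) →ₗ[ℂ] ℂ where
  toFun u := wedge u w U
  map_add' u v := by
    simp only [wedge_eq_det_updateRow]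
    exact Matrix.det_updateRow_add _ _ _ _
  map_smul' c u := by
    simp only [wedge_eq_det_updateRow]
    exact Matrix.det_updateRow_smul _ _ _ _

lemma wedgeLinear_apply (w : Fin 3 → Fin 7 → ℂ) (U : Fin 4 → Fin 7) (u : Fin 7 → ℂ) :
    wedgeLinear w U u = wedge u w U := rfl

/-- Wedging the third exterior power of `ℂ⁷` with one vector has rank at most `(6 choose 3)`. -/
lemma finrank_span_wedge_le (u : Fin 7 → ℂ) :
    finrank ℂ (Submodule.span ℂ (Set.range (wedge u))) ≤ 20 := by
  by_cases hu : u = 0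
  · have : wedge u = 0 := by
      funext w U
      rw [hu, ← wedgeLinear_apply, map_zero]; rfl
    rw [this]
    have h : Set.range (0 : (Fin 3 → Fin 7 → ℂ) → (Fin 4 → Fin 7) → ℂ) ⊆ {0} := by
      rintro _ ⟨w, rfl⟩; rfl
    have h2 := Submodule.span_mono (R := ℂ) h
    rw [Submodule.span_zero_singleton, le_bot_iff] at h2
    rw [h2, finrank_bot]; exact Nat.zero_le _
  · obtain ⟨p, hp⟩ := Function.ne_iff.1 hu
    -- Modulo `u` each `w i` may be replaced by a vector whose coordinate `p` is zero, so the
    -- wedge factors through the third exterior power of a space of dimension six.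
    let s : ({a : Fin 7 // a ≠ p} → ℂ) →ₗ[ℂ] (Fin 7 → ℂ) :=
      LinearMap.funLeft ℂ ℂ (fun a : Fin 7 => if h : a ≠ p then some ⟨a, h⟩ else none) ∘ₗ
        LinearMap.pi (fun o : Option {a : Fin 7 // a ≠ p} =>
          o.elim 0 fun a => LinearMap.proj a)
    have hs : ∀ x a, s x a = if h : a ≠ p then x ⟨a, h⟩ else 0 := by
      intro x a
      by_cases h : a = p <;> simp [s, LinearMap.funLeft_apply, h]
    let g : (Fin 4 → Fin 7) → ({a : Fin 7 // a ≠ p} → ℂ) [⋀^Fin 3]→ₗ[ℂ] ℂ := fun U =>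
      (((Matrix.detRowAlternating (R := ℂ) (n := Fin 4)).compLinearMap
        (LinearMap.funLeft ℂ ℂ U)).curryLeft u).compLinearMap s
    let G : ⋀[ℂ]^3 ({a : Fin 7 // a ≠ p} → ℂ) →ₗ[ℂ] ((Fin 4 → Fin 7) → ℂ) :=
      LinearMap.pi fun U => exteriorPower.alternatingMapLinearEquiv (g U)
    have hle : Submodule.span ℂ (Set.range (wedge u)) ≤ LinearMap.range G := by
      rw [Submodule.span_le]
      rintro _ ⟨w, rfl⟩
      refine ⟨exteriorPower.ιMulti ℂ 3 fun i a => w i a - w i p / u p * u a, ?_⟩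
      funext U
      have h1 : G (exteriorPower.ιMulti ℂ 3 fun i a => w i a - w i p / u p * u a) U =
          wedge u (fun i => s fun a => w i a - w i p / u p * u a) U := by
        simp only [G, LinearMap.pi_apply,
          exteriorPower.alternatingMapLinearEquiv_apply_ιMulti]
        rfl
      rw [h1, wedge, wedge]
      symm
      refine Matrix.det_eq_of_forall_row_eq_smul_add_const
        (Fin.cons 0 fun i => w i p / u p) 0 rfl fun i b => ?_
      refine Fin.cases ?_ (fun i => ?_) i
      · simp
      · simp only [Matrix.of_apply, Matrix.cons_val_succ, Fin.cons_succ, Matrix.cons_val_zero, hs]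
        by_cases h : U b = p
        · simp [h, div_mul_cancel₀ _ hp]
        · simp [h]
    refine (Submodule.finrank_mono hle).trans ((LinearMap.finrank_range_le G).trans ?_)
    rw [exteriorPower.finrank_eq]
    simp [Nat.choose]

section Koszul

variable {ι : Type*}

/-- For a tensor `τ ∈ ℂ^ι ⊗ ℂ^ι ⊗ ℂ⁷`, the image of `e_j ⊗ (w 0 ∧ w 1 ∧ w 2)` under the Koszul
flattening `ℂ^ι ⊗ Λ³ℂ⁷ → ℂ^ι ⊗ Λ⁴ℂ⁷`, in coordinates. -/
noncomputable def koszulVec (τ : ι → ι → Fin 7 → ℂ) (w : Fin 3 → Fin 7 → ℂ) (j : ι) :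
    ι × (Fin 4 → Fin 7) → ℂ :=
  fun p => wedge (τ j p.1) w p.2

/-- The image of the Koszul flattening of `τ`. -/
noncomputable def koszulSpace (τ : ι → ι → Fin 7 → ℂ) :
    Submodule ℂ (ι × (Fin 4 → Fin 7) → ℂ) :=
  Submodule.span ℂ (Set.range fun p : (Fin 3 → Fin 7 → ℂ) × ι => koszulVec τ p.1 p.2)

/-- The rank of the Koszul flattening of `τ`. -/
noncomputable def koszulRank (τ : ι → ι → Fin 7 → ℂ) : ℕ :=
  finrank ℂ (koszulSpace τ)

lemma koszulVec_mem (τ : ι → ι → Fin 7 → ℂ) (w : Fin 3 → Fin 7 → ℂ) (j : ι) :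
    koszulVec τ w j ∈ koszulSpace τ :=
  Submodule.subset_span ⟨(w, j), rfl⟩

lemma koszulSpace_le_iff {τ : ι → ι → Fin 7 → ℂ} {W : Submodule ℂ (ι × (Fin 4 → Fin 7) → ℂ)} :
    koszulSpace τ ≤ W ↔ ∀ w j, koszulVec τ w j ∈ W := by
  rw [koszulSpace, Submodule.span_le, Set.range_subset_iff, Prod.forall]
  rfl

/-- Each rank-one term contributes at most `(6 choose 3)` to the rank of the Koszul flattening. -/
theorem koszulRank_sum_le [Fintype ι] {σ : Type*} (F : Finset σ) (a b : σ → ι → ℂ)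
    (u : σ → Fin 7 → ℂ) :
    koszulRank (fun j l => ∑ s ∈ F, (a s j * b s l) • u s) ≤ 20 * F.card := by
  let m : σ → ((Fin 4 → Fin 7) → ℂ) →ₗ[ℂ] (ι × (Fin 4 → Fin 7) → ℂ) := fun s =>
    LinearMap.pi fun p => b s p.1 • LinearMap.proj p.2
  let W : σ → Submodule ℂ (ι × (Fin 4 → Fin 7) → ℂ) := fun s =>
    (Submodule.span ℂ (Set.range (wedge (u s)))).map (m s)
  have hW : ∀ s, finrank ℂ (W s) ≤ 20 := fun s =>
    (Submodule.finrank_map_le _ _).trans (finrank_span_wedge_le (u s))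
  have hsup : finrank ℂ (F.sup W : Submodule ℂ (ι × (Fin 4 → Fin 7) → ℂ)) ≤ 20 * F.card := by
    classical
    induction F using Finset.induction_on with
    | empty => simp
    | insert s F hs ih =>
      rw [Finset.sup_insert, Finset.card_insert_of_notMem hs]
      have := Submodule.finrank_add_le_finrank_add_finrank (W s) (F.sup W)
      have := hW s
      omega
  refine (Submodule.finrank_mono (koszulSpace_le_iff.2 fun w j => ?_)).trans hsup
  have : koszulVec (fun j l => ∑ s ∈ F, (a s j * b s l) • u s) w j =
      ∑ s ∈ F, a s j • m s (wedge (u s) w) := by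
    funext p
    simp only [koszulVec, ← wedgeLinear_apply, map_sum, map_smul, Finset.sum_apply, Pi.smul_apply,
      m, LinearMap.pi_apply, LinearMap.smul_apply, LinearMap.proj_apply, smul_eq_mul, mul_assoc]
  rw [this]
  exact Submodule.sum_mem _ fun s hs => Submodule.smul_mem _ _
    (Finset.le_sup (f := W) hs (Submodule.mem_map_of_mem (Submodule.subset_span ⟨w, rfl⟩)))

/-- The rank of the Koszul flattening is lower semicontinuous. -/
theorem koszulRank_le_of_tendsto [Fintype ι] {X : Type*} {f : Filter X} [f.NeBot]
    {τ : X → ι → ι → Fin 7 → ℂ} {τ₀ : ι → ι → Fin 7 → ℂ} {N : ℕ}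
    (h : Tendsto τ f (𝓝 τ₀)) (hN : ∀ᶠ x in f, koszulRank (τ x) ≤ N) : koszulRank τ₀ ≤ N := by
  obtain ⟨v, hv, -, hli⟩ := Submodule.exists_fun_fin_finrank_span_eq ℂ
    (Set.range fun p : (Fin 3 → Fin 7 → ℂ) × ι => koszulVec τ₀ p.1 p.2)
  choose q hq using hv
  have hcont : Continuous fun τ : ι → ι → Fin 7 → ℂ =>
      fun i => koszulVec τ (q i).1 (q i).2 := by
    refine continuous_pi fun i => continuous_pi fun p => ?_
    exact (wedgeLinear (q i).1 p.2).continuous_of_finiteDimensional.comp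
      ((continuous_apply p.1).comp (continuous_apply (q i).2))
  have hq' : v = fun i => koszulVec τ₀ (q i).1 (q i).2 := funext fun i => (hq i).symm
  rw [hq'] at hli
  have hev := ((hcont.tendsto τ₀).comp h).eventually hli.eventually
  obtain ⟨x, hx, hxN⟩ := (hev.and hN).exists
  replace hx : LinearIndependent ℂ fun i => koszulVec (τ x) (q i).1 (q i).2 := hx
  have hle : Submodule.span ℂ (Set.range fun i => koszulVec (τ x) (q i).1 (q i).2) ≤
      koszulSpace (τ x) := by
    rw [Submodule.span_le, Set.range_subset_iff]
    exact fun i => koszulVec_mem _ _ _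
  have hcard := Submodule.finrank_mono hle
  rw [finrank_span_eq_card hx, Fintype.card_fin] at hcard
  exact hcard.trans hxN

/-- Acting by matrices on the first two factors does not increase the Koszul rank. -/
theorem koszulRank_matrix_act_le [Fintype ι] (g h : ι → ι → ℂ) (τ : ι → ι → Fin 7 → ℂ) :
    koszulRank (fun j l => ∑ j', ∑ l', (g j j' * h l l') • τ j' l') ≤ koszulRank τ := by
  let H : (ι × (Fin 4 → Fin 7) → ℂ) →ₗ[ℂ] (ι × (Fin 4 → Fin 7) → ℂ) :=
    LinearMap.pi fun p => ∑ l', h p.1 l' • LinearMap.proj (l', p.2)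
  refine (Submodule.finrank_mono (koszulSpace_le_iff.2 fun w j => ?_)).trans
    (Submodule.finrank_map_le H (koszulSpace τ))
  have : koszulVec (fun j l => ∑ j', ∑ l', (g j j' * h l l') • τ j' l') w j =
      ∑ j', g j j' • H (koszulVec τ w j') := by
    funext p
    simp only [koszulVec, ← wedgeLinear_apply, map_sum, map_smul, Finset.sum_apply, Pi.smul_apply,
      H, LinearMap.pi_apply, LinearMap.sum_apply, LinearMap.smul_apply, LinearMap.proj_apply,
      smul_eq_mul, mul_assoc, Finset.mul_sum]
  rw [this]
  exact Submodule.sum_mem _ fun j' _ => Submodule.smul_mem _ _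
    (Submodule.mem_map_of_mem (koszulVec_mem _ _ _))

end Koszul

/-! ### The rank of one explicit Koszul flattening -/

/-- The minor of the identity matrix in increasing rows `a < b < c` and increasing columns
`d < e < f`. -/
lemma delta_minor {α : Type*} [LinearOrder α] {a b c d e f : α} (hab : a < b) (hbc : b < c)
    (hde : d < e) (hef : e < f) :
    Matrix.det (Matrix.of fun i j => (Pi.single (![a, b, c] i) 1 : α → ℂ) (![d, e, f] j)) =
      if (d, e, f) = (a, b, c) then (1 : ℂ) else 0 := by
  rw [Matrix.det_fin_three]
  simp only [Matrix.of_apply, Pi.single_apply, Prod.mk.injEq, Matrix.cons_val_zero,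
    Matrix.cons_val_one, Matrix.cons_val]
  have hac := hab.trans hbc
  have hdf := hde.trans hef
  rcases lt_trichotomy a d with h | rfl | h
  · simp [h.ne', (h.trans hde).ne', (h.trans hdf).ne']
  · have : ¬ (f = b ∧ e = c) := fun ⟨h1, h2⟩ => by
      subst h1 h2; exact lt_asymm hbc hef
    simp [hab.ne, hac.ne, hde.ne', hdf.ne', ite_and]
    by_cases h1 : e = b <;> by_cases h2 : f = c <;> by_cases h3 : f = b <;>
      by_cases h4 : e = c <;> simp_all
  · simp [h.ne, (h.trans hab).ne, (h.trans hac).ne]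

/-- Laplace expansion of the wedge of `x` with three basis vectors along `x`. -/
lemma wedge_single (x : Fin 7 → ℂ) {a b c p q r t : Fin 7} (hab : a < b) (hbc : b < c)
    (hpq : p < q) (hqr : q < r) (hrt : r < t) :
    wedge x (fun i => Pi.single (![a, b, c] i) 1) ![p, q, r, t] =
      (if (q, r, t) = (a, b, c) then x p else 0) - (if (p, r, t) = (a, b, c) then x q else 0) +
      (if (p, q, t) = (a, b, c) then x r else 0) - (if (p, q, r) = (a, b, c) then x t else 0) := by
  have h (v : Fin 3 → Fin 7) (i : Fin 4) (hv : ![p, q, r, t] ∘ i.succAbove = v) :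
      ((Matrix.of fun i j => (Matrix.vecCons x (fun i => Pi.single (![a, b, c] i) 1) :
        Fin 4 → Fin 7 → ℂ) i (![p, q, r, t] j)).submatrix Fin.succ i.succAbove) =
      Matrix.of fun i j => (Pi.single (![a, b, c] i) 1 : Fin 7 → ℂ) (v j) := by
    subst hv; rfl
  rw [wedge, Matrix.det_succ_row_zero, Fin.sum_univ_four,
    h ![q, r, t] 0 (by ext i; fin_cases i <;> rfl), h ![p, r, t] 1 (by ext i; fin_cases i <;> rfl),
    h ![p, q, t] 2 (by ext i; fin_cases i <;> rfl), h ![p, q, r] 3 (by ext i; fin_cases i <;> rfl),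
    delta_minor hab hbc hqr hrt, delta_minor hab hbc (hpq.trans hqr) hrt,
    delta_minor hab hbc hpq (hqr.trans hrt), delta_minor hab hbc hpq hqr]
  simp only [Fin.val_zero, pow_zero, one_mul, Fin.val_one, pow_one]
  split_ifs <;> simp <;> ring

/-- The bracket of `so₅` in split coordinates modulo `e_0`, `e_1` and `e_5 + e_9`, as sparse data:
entry `j` of the list consists of the triples `(l, a, x)` for which `x ≠ 0` is the coordinate `a` of
the image of `[e_j, e_l]` in the quotient. -/
def bracketTable : List (List (ℕ × ℕ × ℤ)) :=
  [[(8, 2, 1), (9, 1, 1), (9, 6, -1)],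
   [(6, 2, -1), (7, 0, 1), (8, 1, 1), (9, 4, 1)],
   [(3, 0, -1), (5, 0, 1), (6, 1, 1), (6, 6, 1), (8, 4, -1)],
   [(2, 0, 1), (6, 3, -1), (8, 5, -1), (9, 6, -1)],
   [(5, 2, -1), (7, 6, -1), (8, 3, 1), (9, 5, -1)],
   [(2, 0, -1), (4, 2, 1), (6, 3, 1), (7, 4, -1), (9, 6, -1)],
   [(1, 2, 1), (2, 1, -1), (2, 6, -1), (3, 3, 1), (5, 3, -1), (7, 5, -1)],
   [(1, 0, -1), (4, 6, 1), (5, 4, 1), (6, 5, 1), (8, 6, -1)],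
   [(0, 2, -1), (1, 1, -1), (2, 4, 1), (3, 5, 1), (4, 3, -1), (7, 6, 1)],
   [(0, 1, -1), (0, 6, 1), (1, 4, -1), (3, 6, 1), (4, 5, 1), (5, 6, 1)]]


/-- The value at `(l, a)` of a table of triples `(l, a, x)`. -/
def tableValue (t : List (ℕ × ℕ × ℤ)) (l a : ℕ) : ℤ :=
  (t.map fun e => if e.1 = l ∧ e.2.1 = a then e.2.2 else 0).sum

/-- The increasing triples of numbers below `7`. -/
def triples : List (ℕ × ℕ × ℕ) :=
  (List.range 7).flatMap fun c => (List.range c).flatMap fun b =>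
    (List.range b).map fun a => (a, b, c)

/-- The increasing quadruples of numbers below `7`. -/
def quadruples : List (ℕ × ℕ × ℕ × ℕ) :=
  (List.range 7).flatMap fun d => (List.range d).flatMap fun c =>
    (List.range c).flatMap fun b => (List.range b).map fun a => (a, b, c, d)

/-- The first of the ten consecutive positions that belong to a quadruple, one for each basis vector
of the first tensor factor `ℂ¹⁰` of the target. -/
def position (u : ℕ × ℕ × ℕ × ℕ) : ℕ :=
  10 * u.1 + (100 * u.2.1 + (1000 * u.2.2.1 + 10000 * u.2.2.2))

/-- The triples that arise from a quadruple by deleting one entry, each with the sign of the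
deletion and the deleted entry. -/
def faces (u : ℕ × ℕ × ℕ × ℕ) : List ((ℕ × ℕ × ℕ) × ℤ × ℕ) :=
  [((u.2.1, u.2.2.1, u.2.2.2), 1, u.1), ((u.1, u.2.2.1, u.2.2.2), -1, u.2.1),
    ((u.1, u.2.1, u.2.2.2), 1, u.2.2.1), ((u.1, u.2.1, u.2.2.1), -1, u.2.2.2)]

/-- Equality of triples, by the comparison of numbers that the kernel accelerates. -/
def tripleBeq (s t : ℕ × ℕ × ℕ) : Bool :=
  Nat.beq s.1 t.1 && (Nat.beq s.2.1 t.2.1 && Nat.beq s.2.2 t.2.2)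

/-- The nonzero coordinates of `x ∧ e_a ∧ e_b ∧ e_c`, where `s = (a, b, c)`: the entry `(n, ε, d)`
says that `ε x_d` is the coordinate with first position `n`. -/
def wedgeEntries (s : ℕ × ℕ × ℕ) : List (ℕ × ℤ × ℕ) :=
  quadruples.flatMap fun u => (faces u).filterMap fun f =>
    bif tripleBeq f.1 s then some (position u, f.2) else none

/-- A row of the Koszul flattening, as a sparse row. -/
def koszulRow (w : List (ℕ × ℤ × ℕ)) (t : List (ℕ × ℕ × ℤ)) : List (ℕ × ℤ) :=
  w.flatMap fun u => t.filterMap fun e =>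
    bif Nat.beq e.2.1 u.2.2 then some (u.1 + e.1, u.2.1 * e.2.2) else none

/-- All rows of the Koszul flattening. -/
def koszulRows : List (List (ℕ × ℤ)) :=
  triples.flatMap fun s => bracketTable.map fun t => koszulRow (wedgeEntries s) t

/-- Elimination finds `322` pivots; `321` suffice. -/
theorem le_elimCount_koszulRows : Nat.ble 321 (elimCount 350 koszulRows) = true := by
  decide +kernel

lemma triples_spec : ∀ s ∈ triples, s.1 < s.2.1 ∧ s.2.1 < s.2.2 ∧ s.2.2 < 7 := by decide

lemma quadruples_spec :
    ∀ u ∈ quadruples, u.1 < u.2.1 ∧ u.2.1 < u.2.2.1 ∧ u.2.2.1 < u.2.2.2 ∧ u.2.2.2 < 7 := by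
  decide

lemma tripleBeq_eq_decide (s t : ℕ × ℕ × ℕ) : tripleBeq s t = decide (s = t) := by
  rw [Bool.eq_iff_iff]
  simp [tripleBeq, Prod.ext_iff]

lemma rowVec_flatMap {α : Type*} (L : List α) (f : α → List (ℕ × ℤ)) :
    rowVec (L.flatMap f) = (L.map fun x => rowVec (f x)).sum := by
  induction L with
  | nil => rfl
  | cons x L ih => rw [List.flatMap_cons, rowVec_append, ih, List.map_cons, List.sum_cons]

/-- The part of a row that comes from one coordinate of a wedge. -/
lemma rowVec_table (n a : ℕ) (ε : ℤ) (t : List (ℕ × ℕ × ℤ)) (ht : ∀ e ∈ t, e.1 < 10) :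
    rowVec (t.filterMap fun e => bif Nat.beq e.2.1 a then some (n + e.1, ε * e.2.2) else none) =
      ∑ l : Fin 10, Pi.single (n + l) ((ε * tableValue t l a : ℤ) : ℂ) := by
  induction t with
  | nil => simp [tableValue]
  | cons e t ih =>
    have h1 : ∑ l : Fin 10, (Pi.single (n + l) ((ε * tableValue (e :: t) l a : ℤ) : ℂ) : ℕ → ℂ) =
        (if e.2.1 = a then Pi.single (n + e.1) ((ε * e.2.2 : ℤ) : ℂ) else 0) +
          ∑ l : Fin 10, Pi.single (n + l) ((ε * tableValue t l a : ℤ) : ℂ) := by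
      have h2 (l : Fin 10) : (Pi.single (n + l) ((ε * tableValue (e :: t) l a : ℤ) : ℂ) : ℕ → ℂ) =
          (if (⟨e.1, ht e List.mem_cons_self⟩ : Fin 10) = l then
            if e.2.1 = a then Pi.single (n + e.1) ((ε * e.2.2 : ℤ) : ℂ) else 0 else 0) +
          Pi.single (n + l) ((ε * tableValue t l a : ℤ) : ℂ) := by
        by_cases h : (⟨e.1, ht e List.mem_cons_self⟩ : Fin 10) = l
        · have h' : e.1 = l := congrArg Fin.val h
          by_cases h3 : e.2.1 = a
          · simp [tableValue, h', h3, mul_add, Pi.single_add]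
          · simp [tableValue, h3]
        · have h' : ¬ e.1 = l := fun h' => h (Fin.ext h')
          simp [tableValue, h', h]
      rw [Finset.sum_congr rfl fun l _ => h2 l, Finset.sum_add_distrib, Finset.sum_ite_eq,
        if_pos (Finset.mem_univ _)]
    rw [h1, ← ih fun e he => ht e (List.mem_cons_of_mem _ he)]
    by_cases h : e.2.1 = a
    · simp [h]
    · have h' : Nat.beq e.2.1 a = false := by rw [← Bool.not_eq_true, Nat.beq_eq]; exact h
      simp [h, h']

/-- Re-indexing of the coordinates of the target of the Koszul flattening by positions, keeping
only the increasing quadruples. -/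
noncomputable def toPositions : (Fin 10 × (Fin 4 → Fin 7) → ℂ) →ₗ[ℂ] (ℕ → ℂ) where
  toFun ψ := (quadruples.map fun u => ∑ l : Fin 10, Pi.single (position u + l)
    (ψ (l, ![Fin.ofNat 7 u.1, Fin.ofNat 7 u.2.1, Fin.ofNat 7 u.2.2.1, Fin.ofNat 7 u.2.2.2]))).sum
  map_add' ψ χ := by
    simp only [Pi.add_apply, Pi.single_add, Finset.sum_add_distrib, List.sum_map_add]
  map_smul' c ψ := by
    simp only [Pi.smul_apply, Pi.single_smul, ← Finset.smul_sum, RingHom.id_apply,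
      List.smul_sum, List.map_map]
    rfl

lemma toPositions_apply (ψ : Fin 10 × (Fin 4 → Fin 7) → ℂ) :
    toPositions ψ = (quadruples.map fun u => ∑ l : Fin 10, Pi.single (position u + l) (ψ (l,
      ![Fin.ofNat 7 u.1, Fin.ofNat 7 u.2.1, Fin.ofNat 7 u.2.2.1, Fin.ofNat 7 u.2.2.2]))).sum :=
  rfl

/-- The part of a row at the positions of one quadruple. -/
lemma rowVec_faces (n : ℕ) (s : ℕ × ℕ × ℕ) (t : List (ℕ × ℕ × ℤ)) (ht : ∀ e ∈ t, e.1 < 10)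
    (L : List ((ℕ × ℕ × ℕ) × ℤ × ℕ)) :
    rowVec (koszulRow (L.filterMap fun f => bif tripleBeq f.1 s then some (n, f.2) else none) t) =
      (L.map fun f => if f.1 = s then
        ∑ l : Fin 10, Pi.single (n + l) ((f.2.1 * tableValue t l f.2.2 : ℤ) : ℂ) else 0).sum := by
  induction L with
  | nil => rfl
  | cons f L ih =>
    rw [List.map_cons, List.sum_cons, ← ih]
    by_cases h : f.1 = s
    · have h' : tripleBeq f.1 s = true := by simp [tripleBeq_eq_decide, h]
      rw [List.filterMap_cons_some (b := (n, f.2)) (by simp [h']), koszulRow, List.flatMap_cons,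
        rowVec_append, rowVec_table _ _ _ _ ht, if_pos h]
      rfl
    · have h' : tripleBeq f.1 s = false := by simp [tripleBeq_eq_decide, h]
      rw [List.filterMap_cons_none (by simp [h']), if_neg h, zero_add]

lemma rowVec_koszulRow {τ : Fin 10 → Fin 10 → Fin 7 → ℂ} {j : Fin 10} {t : List (ℕ × ℕ × ℤ)}
    (hτ : ∀ l a, τ j l a = tableValue t l a) (ht : ∀ e ∈ t, e.1 < 10)
    {s : ℕ × ℕ × ℕ} (hs : s ∈ triples) :
    rowVec (koszulRow (wedgeEntries s) t) = toPositions (koszulVec τ (fun i =>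
      (Pi.single (![Fin.ofNat 7 s.1, Fin.ofNat 7 s.2.1, Fin.ofNat 7 s.2.2] i) 1 :
        Fin 7 → ℂ)) j) := by
  obtain ⟨h1, h2, h3⟩ := triples_spec s hs
  obtain ⟨a, b, c⟩ := s
  simp only at h1 h2 h3
  lift a to Fin 7 using by omega with a
  lift b to Fin 7 using by omega with b
  lift c to Fin 7 using by omega with c
  rw [koszulRow, wedgeEntries, List.flatMap_assoc, rowVec_flatMap]
  rw [toPositions_apply]
  refine congrArg List.sum (List.map_congr_left fun u hu => ?_)
  refine (rowVec_faces (position u) _ t ht (faces u)).trans ?_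
  obtain ⟨h4, h5, h6, h7⟩ := quadruples_spec u hu
  obtain ⟨p, q, r, t'⟩ := u
  simp only at h4 h5 h6 h7
  lift p to Fin 7 using by omega with p
  lift q to Fin 7 using by omega with q
  lift r to Fin 7 using by omega with r
  lift t' to Fin 7 using by omega with t'
  have hval (x : Fin 7) : Fin.ofNat 7 x = x := Fin.ofNat_val_eq_self x
  simp only [hval, koszulVec]
  have hw (l : Fin 10) := wedge_single (τ j l) h1 h2 h4 h5 h6
  simp only [hw]
  simp only [faces, List.map_cons, List.map_nil, List.sum_cons, List.sum_nil, hτ, Prod.mk.injEq,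
    Fin.val_inj]
  split_ifs <;> simp [← Finset.sum_add_distrib, -Finset.sum_neg_distrib, Pi.single_add,
    Pi.single_neg,
    sub_eq_add_neg, add_assoc]

lemma bracketTable_spec : ∀ t ∈ bracketTable, ∀ e ∈ t, e.1 < 10 := by decide

/-- The explicit tensor given by `bracketTable` has Koszul rank at least `321`. -/
theorem le_koszulRank_of_bracketTable {τ : Fin 10 → Fin 10 → Fin 7 → ℂ}
    (hτ : ∀ j l a, τ j l a = tableValue (bracketTable.getD j []) l a) : 321 ≤ koszulRank τ := by
  refine (Nat.le_of_ble_eq_true le_elimCount_koszulRows).trans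
    ((elimCount_le_finrank _ _).trans ((Submodule.finrank_mono ?_).trans
      (Submodule.finrank_map_le toPositions (koszulSpace τ))))
  rw [rowSpace_le_iff]
  intro r hr
  obtain ⟨s, hs, t, ht, rfl⟩ : ∃ s ∈ triples, ∃ t ∈ bracketTable,
      koszulRow (wedgeEntries s) t = r := by
    simpa [koszulRows] using hr
  obtain ⟨j, hj, rfl⟩ := List.getElem_of_mem ht
  rw [rowVec_koszulRow (τ := τ) (j := ⟨j, hj⟩) (fun l a => ?_) (bracketTable_spec _ ht) hs]
  · exact Submodule.mem_map_of_mem (koszulVec_mem _ _ _)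
  · rw [hτ, List.getD_eq_getElem _ _ hj]

/-! ### The bound that two killed vectors impose -/

/-- The condition that every projection `ℂ¹⁰ → ℂ⁷` of the third factor of the tensor
`∑ e_j ⊗ e_l ⊗ t j l` that kills `x` and `y` leaves a tensor of Koszul rank at most
`320 = (18 - 2) * 20`. -/
def KoszulBound (t : Fin 10 → Fin 10 → Fin 10 → ℂ) (x y : Fin 10 → ℂ) : Prop :=
  ∀ φ : (Fin 10 → ℂ) →ₗ[ℂ] (Fin 7 → ℂ), φ x = 0 → φ y = 0 →
    koszulRank (fun j l => φ (t j l)) ≤ 320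

lemma KoszulBound.of_mem_span {t : Fin 10 → Fin 10 → Fin 10 → ℂ} {x y x' y' : Fin 10 → ℂ}
    (h : KoszulBound t x y) (hx : x ∈ Submodule.span ℂ {x', y'})
    (hy : y ∈ Submodule.span ℂ {x', y'}) : KoszulBound t x' y' := by
  intro φ hx' hy'
  have hle : Submodule.span ℂ {x', y'} ≤ LinearMap.ker φ := by
    rw [Submodule.span_le, Set.insert_subset_iff, Set.singleton_subset_iff]
    exact ⟨hx', hy'⟩
  exact h φ (hle hx) (hle hy)

/-- Two of eighteen rank-one terms disappear in a quotient that kills two of the vectors. -/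
theorem koszulBound_of_sum (a b c : Fin 18 → Fin 10 → ℂ) :
    KoszulBound (fun j l => ∑ s, (a s j * b s l) • c s) (c 0) (c 1) := by
  intro φ h0 h1
  have h : (fun j l => φ (∑ s, (a s j * b s l) • c s)) =
      fun j l => ∑ s ∈ Finset.univ \ {0, 1}, (a s j * b s l) • φ (c s) := by
    funext j l
    rw [map_sum]
    simp only [map_smul]
    refine (Finset.sum_subset (Finset.subset_univ _) fun s _ hs => ?_).symm
    have : s = 0 ∨ s = 1 := by simpa [or_iff_not_imp_left] using hs
    rcases this with rfl | rfl <;> simp [h0, h1]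
  rw [h]
  refine (koszulRank_sum_le _ a b fun s => φ (c s)).trans ?_
  rw [show (Finset.univ \ {0, 1} : Finset (Fin 18)).card = 16 by decide]

/-- `KoszulBound` passes to limits in which the two vectors stay linearly independent. -/
theorem koszulBound_of_tendsto {X : Type*} {f : Filter X} [f.NeBot]
    {t : X → Fin 10 → Fin 10 → Fin 10 → ℂ} {t₀ : Fin 10 → Fin 10 → Fin 10 → ℂ}
    {x y : X → Fin 10 → ℂ} {x₀ y₀ : Fin 10 → ℂ} (ht : Tendsto t f (𝓝 t₀))
    (hx : Tendsto x f (𝓝 x₀)) (hy : Tendsto y f (𝓝 y₀)) {k m : Fin 10}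
    (hΔ : x₀ k * y₀ m - x₀ m * y₀ k ≠ 0) (h : ∀ᶠ n in f, KoszulBound (t n) (x n) (y n)) :
    KoszulBound t₀ x₀ y₀ := by
  intro φ hφx hφy
  -- Cramer's rule corrects `φ` to a map that kills `x n` and `y n`.
  let ψ : (Fin 10 → ℂ) →ₗ[ℂ] (Fin 7 → ℂ) := (x₀ k * y₀ m - x₀ m * y₀ k)⁻¹ • φ
  let Φ : X → (Fin 10 → ℂ) →ₗ[ℂ] (Fin 7 → ℂ) := fun n =>
    (x n k * y n m - x n m * y n k) • ψ -
      (y n m • LinearMap.proj k - y n k • LinearMap.proj m : (Fin 10 → ℂ) →ₗ[ℂ] ℂ).smulRight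
        (ψ (x n)) -
      (x n k • LinearMap.proj m - x n m • LinearMap.proj k : (Fin 10 → ℂ) →ₗ[ℂ] ℂ).smulRight
        (ψ (y n))
  have hΦ (n : X) (v : Fin 10 → ℂ) : Φ n v = (x n k * y n m - x n m * y n k) • ψ v -
      (y n m * v k - y n k * v m) • ψ (x n) - (x n k * v m - x n m * v k) • ψ (y n) := by
    simp [Φ]
  have hψx : ψ x₀ = 0 := by simp [ψ, hφx]
  have hψy : ψ y₀ = 0 := by simp [ψ, hφy]
  have hc : Continuous ψ := ψ.continuous_of_finiteDimensional
  refine koszulRank_le_of_tendsto (f := f) (τ := fun n j l => Φ n (t n j l)) ?_ ?_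
  · rw [tendsto_pi_nhds]
    intro j
    rw [tendsto_pi_nhds]
    intro l
    have htjl : Tendsto (fun n => t n j l) f (𝓝 (t₀ j l)) :=
      tendsto_pi_nhds.1 (tendsto_pi_nhds.1 ht j) l
    have hxi := tendsto_pi_nhds.1 hx
    have hyi := tendsto_pi_nhds.1 hy
    have hti := tendsto_pi_nhds.1 htjl
    have hlim : Tendsto (fun n => Φ n (t n j l)) f
        (𝓝 ((x₀ k * y₀ m - x₀ m * y₀ k) • ψ (t₀ j l) -
          (y₀ m * t₀ j l k - y₀ k * t₀ j l m) • ψ x₀ -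
          (x₀ k * t₀ j l m - x₀ m * t₀ j l k) • ψ y₀)) := by
      simp only [hΦ]
      exact (((((hxi k).mul (hyi m)).sub ((hxi m).mul (hyi k))).smul
        ((hc.tendsto _).comp htjl)).sub
        ((((hyi m).mul (hti k)).sub ((hyi k).mul (hti m))).smul ((hc.tendsto _).comp hx))).sub
        ((((hxi k).mul (hti m)).sub ((hxi m).mul (hti k))).smul ((hc.tendsto _).comp hy))
    rw [hψx, hψy, smul_zero, smul_zero, sub_zero, sub_zero, LinearMap.smul_apply,
      smul_inv_smul₀ hΔ] at hlim
    exact hlim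
  · filter_upwards [h] with n hn
    refine hn (Φ n) ?_ ?_
    · rw [hΦ]; module
    · rw [hΦ]; module

/-- The tensor of a bilinear map, in coordinates. -/
def bilinTensor (B : (Fin 10 → ℂ) →ₗ[ℂ] (Fin 10 → ℂ) →ₗ[ℂ] (Fin 10 → ℂ)) :
    Fin 10 → Fin 10 → Fin 10 → ℂ :=
  fun j l => B (Pi.single j 1) (Pi.single l 1)

/-- Automorphisms of a bilinear map respect `KoszulBound`. -/
theorem KoszulBound.map_automorphism
    {B : (Fin 10 → ℂ) →ₗ[ℂ] (Fin 10 → ℂ) →ₗ[ℂ] (Fin 10 → ℂ)}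
    {g g' : (Fin 10 → ℂ) →ₗ[ℂ] (Fin 10 → ℂ)} (hgg' : ∀ v, g (g' v) = v)
    (hg : ∀ v w, B (g v) (g w) = g (B v w)) {x y : Fin 10 → ℂ}
    (h : KoszulBound (bilinTensor B) x y) : KoszulBound (bilinTensor B) (g x) (g y) := by
  intro φ hx hy
  refine le_trans (le_of_eq ?_) ((koszulRank_matrix_act_le (fun j => g' (Pi.single j 1))
    (fun j => g' (Pi.single j 1)) _).trans (h (φ ∘ₗ g) hx hy))
  congr 1
  funext j l
  have hsum (v : Fin 10 → ℂ) : v = ∑ i, v i • (Pi.single i 1 : Fin 10 → ℂ) := by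
    conv_lhs => rw [← Finset.univ_sum_single v]
    refine Finset.sum_congr rfl fun i _ => ?_
    rw [← Pi.single_smul, smul_eq_mul, mul_one]
  have h1 (v w : Fin 10 → ℂ) : B v w =
      ∑ j', ∑ l', (v j' * w l') • B (Pi.single j' 1) (Pi.single l' 1) := by
    conv_lhs => rw [hsum v, hsum w]
    simp only [map_sum, map_smul, LinearMap.sum_apply, LinearMap.smul_apply, Finset.smul_sum,
      smul_smul]
    rw [Finset.sum_comm]
    exact Finset.sum_congr rfl fun _ _ => Finset.sum_congr rfl fun _ _ => by rw [mul_comm]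
  have h2 : bilinTensor B j l = g (B (g' (Pi.single j 1)) (g' (Pi.single l 1))) := by
    rw [← hg, hgg', hgg', bilinTensor]
  rw [h2, h1]
  simp only [map_sum, map_smul, LinearMap.comp_apply, bilinTensor]

/-! ### The orthogonal Lie algebra in split coordinates -/

section SplitForm

variable {R : Type*} [CommRing R]

/-- The skew-symmetric matrix with given entries above the diagonal. -/
def skewMatrix (v : Fin 10 → R) : Matrix (Fin 5) (Fin 5) R :=
  !![0, v 0, v 1, v 2, v 3;
    -v 0, 0, v 4, v 5, v 6;
    -v 1, -v 4, 0, v 7, v 8;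
    -v 2, -v 5, -v 7, 0, v 9;
    -v 3, -v 6, -v 8, -v 9, 0]

/-- The entries of a matrix above the diagonal, in the order used by `skewMatrix`. -/
def upperEntries (Y : Matrix (Fin 5) (Fin 5) R) : Fin 10 → R :=
  ![Y 0 1, Y 0 2, Y 0 3, Y 0 4, Y 1 2, Y 1 3, Y 1 4, Y 2 3, Y 2 4, Y 3 4]

variable (R) in
/-- The matrix of the split quadratic form: the coordinates `0, 1` and `4, 3` are dual isotropic
planes, and the coordinate `2` is anisotropic. -/
def splitForm : Matrix (Fin 5) (Fin 5) R :=
  !![0, 0, 0, 0, 1; 0, 0, 0, 1, 0; 0, 0, 1, 0, 0; 0, 1, 0, 0, 0; 1, 0, 0, 0, 0]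

/-- The bracket of the orthogonal Lie algebra of the form `splitForm`, transported to
skew-symmetric matrices by multiplication with `splitForm`. -/
def splitBracket (v w : Fin 10 → R) : Fin 10 → R :=
  upperEntries (skewMatrix v * splitForm R * skewMatrix w -
    skewMatrix w * splitForm R * skewMatrix v)

lemma upperEntries_skewMatrix (v : Fin 10 → R) : upperEntries (skewMatrix v) = v := by
  ext i; fin_cases i <;> rfl

lemma skewMatrix_upperEntries {Y : Matrix (Fin 5) (Fin 5) R} (h : Yᵀ = -Y)
    (h0 : ∀ i, Y i i = 0) : skewMatrix (upperEntries Y) = Y := by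
  have h' (i j : Fin 5) : -Y i j = Y j i := (congrFun (congrFun h i) j).symm
  ext i j
  fin_cases i <;> fin_cases j <;> simp [skewMatrix, upperEntries, h0, h']

lemma skewMatrix_transpose (v : Fin 10 → R) : (skewMatrix v)ᵀ = -skewMatrix v := by
  ext i j
  fin_cases i <;> fin_cases j <;> simp [skewMatrix]

lemma skewMatrix_injective : Function.Injective (skewMatrix (R := R)) :=
  Function.LeftInverse.injective upperEntries_skewMatrix

lemma skewMatrix_add (v w : Fin 10 → R) : skewMatrix (v + w) = skewMatrix v + skewMatrix w := by
  ext i j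
  fin_cases i <;> fin_cases j <;> simp [skewMatrix, add_comm]

lemma skewMatrix_smul (c : R) (v : Fin 10 → R) : skewMatrix (c • v) = c • skewMatrix v := by
  ext i j
  fin_cases i <;> fin_cases j <;> simp [skewMatrix]

lemma upperEntries_add (Y Z : Matrix (Fin 5) (Fin 5) R) :
    upperEntries (Y + Z) = upperEntries Y + upperEntries Z := by
  ext i; fin_cases i <;> rfl

lemma upperEntries_smul (c : R) (Y : Matrix (Fin 5) (Fin 5) R) :
    upperEntries (c • Y) = c • upperEntries Y := by
  ext i; fin_cases i <;> rfl

lemma splitForm_transpose : (splitForm R)ᵀ = splitForm R := by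
  ext i j
  fin_cases i <;> fin_cases j <;> rfl

lemma splitForm_mul_self : splitForm R * splitForm R = 1 := by
  ext i j
  fin_cases i <;> fin_cases j <;> simp [splitForm, Matrix.mul_apply, Fin.sum_univ_five]

/-- The bracket is defined over `ℤ`, where it can be evaluated. -/
lemma splitBracket_map {S : Type*} [CommRing S] (f : R →+* S) (v w : Fin 10 → R) :
    splitBracket (f ∘ v) (f ∘ w) = f ∘ splitBracket v w := by
  have h1 (v : Fin 10 → R) : skewMatrix (f ∘ v) = (skewMatrix v).map f := by
    ext i j
    fin_cases i <;> fin_cases j <;> simp [skewMatrix]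
  have h2 : splitForm S = (splitForm R).map f := by
    ext i j
    fin_cases i <;> fin_cases j <;> simp [splitForm]
  have h3 (Y : Matrix (Fin 5) (Fin 5) R) : upperEntries (Y.map f) = f ∘ upperEntries Y := by
    ext i; fin_cases i <;> rfl
  rw [splitBracket, splitBracket, h1, h1, h2, ← h3, Matrix.map_sub f (map_sub f), Matrix.map_mul,
    Matrix.map_mul, Matrix.map_mul, Matrix.map_mul]

end SplitForm

lemma skewMatrix_upperEntries_of_transpose {Y : Matrix (Fin 5) (Fin 5) ℂ} (h : Yᵀ = -Y) :
    skewMatrix (upperEntries Y) = Y :=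
  skewMatrix_upperEntries h fun i => self_eq_neg.1 (congrFun (congrFun h i) i)

lemma skewMatrix_splitBracket (v w : Fin 10 → ℂ) :
    skewMatrix (splitBracket v w) = skewMatrix v * splitForm ℂ * skewMatrix w -
      skewMatrix w * splitForm ℂ * skewMatrix v := by
  refine skewMatrix_upperEntries_of_transpose ?_
  simp only [Matrix.transpose_sub, Matrix.transpose_mul, skewMatrix_transpose, splitForm_transpose,
    Matrix.mul_assoc, Matrix.neg_mul, Matrix.mul_neg, neg_neg, neg_sub]

/-- `splitBracket` as a bilinear map. -/
def splitBracketLinear : (Fin 10 → ℂ) →ₗ[ℂ] (Fin 10 → ℂ) →ₗ[ℂ] (Fin 10 → ℂ) :=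
  LinearMap.mk₂ ℂ splitBracket
    (fun u v w => skewMatrix_injective <| by
      simp only [skewMatrix_splitBracket, skewMatrix_add]; noncomm_ring)
    (fun c v w => skewMatrix_injective <| by
      simp only [skewMatrix_splitBracket, skewMatrix_smul, Matrix.smul_mul, Matrix.mul_smul,
        smul_sub])
    (fun u v w => skewMatrix_injective <| by
      simp only [skewMatrix_splitBracket, skewMatrix_add]; noncomm_ring)
    (fun c v w => skewMatrix_injective <| by
      simp only [skewMatrix_splitBracket, skewMatrix_smul, Matrix.smul_mul, Matrix.mul_smul,
        smul_sub])

/-- The structure tensor in the split coordinates. -/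
def splitTensor : Fin 10 → Fin 10 → Fin 10 → ℂ := bilinTensor splitBracketLinear

/-- The quotient of `R¹⁰` by `e_0`, `e_1` and `e_5 + e_9`, in coordinates. -/
def killCoords {R : Type*} [CommRing R] (v : Fin 10 → R) : Fin 7 → R :=
  ![v 2, v 3, v 4, v 6, v 7, v 8, v 9 - v 5]

/-- `killCoords` as a linear map. -/
def killMap : (Fin 10 → ℂ) →ₗ[ℂ] (Fin 7 → ℂ) where
  toFun := killCoords
  map_add' v w := by ext a; fin_cases a <;> simp [killCoords, add_sub_add_comm]
  map_smul' c v := by ext a; fin_cases a <;> simp [killCoords, mul_sub]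

lemma killCoords_splitBracket_eq_tableValue : ∀ j l : Fin 10, ∀ a : Fin 7,
    killCoords (splitBracket (Pi.single j (1 : ℤ)) (Pi.single l 1)) a =
      tableValue (bracketTable.getD j []) l a := by
  decide +kernel

lemma killMap_splitTensor (j l : Fin 10) (a : Fin 7) :
    killMap (splitTensor j l) a = tableValue (bracketTable.getD j []) l a := by
  have hs (j : Fin 10) : (Pi.single j 1 : Fin 10 → ℂ) =
      Int.castRingHom ℂ ∘ (Pi.single j 1 : Fin 10 → ℤ) := by
    ext i
    simp [Pi.single_apply]
  have h : splitTensor j l = Int.castRingHom ℂ ∘ splitBracket (Pi.single j 1) (Pi.single l 1) := by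
    rw [← splitBracket_map, ← hs, ← hs]
    rfl
  rw [h, ← killCoords_splitBracket_eq_tableValue]
  fin_cases a <;> simp [killMap, killCoords]

/-- `KoszulBound` fails for the plane of the two highest root vectors. -/
theorem not_koszulBound_splitTensor :
    ¬ KoszulBound splitTensor (Pi.single 0 1) (Pi.single 1 1) := by
  intro h
  have h1 := h killMap (by ext a; fin_cases a <;> simp [killMap, killCoords])
    (by ext a; fin_cases a <;> simp [killMap, killCoords])
  have h2 := le_koszulRank_of_bracketTable killMap_splitTensor
  omega

/-! ### The action of the orthogonal group -/

/-- The action `Y ↦ M * Y * Mᵀ` on skew-symmetric matrices, in coordinates. -/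
def skewAct (M : Matrix (Fin 5) (Fin 5) ℂ) : (Fin 10 → ℂ) →ₗ[ℂ] (Fin 10 → ℂ) where
  toFun v := upperEntries (M * skewMatrix v * Mᵀ)
  map_add' v w := by rw [skewMatrix_add, Matrix.mul_add, Matrix.add_mul, upperEntries_add]
  map_smul' c v := by
    rw [skewMatrix_smul, Matrix.mul_smul, Matrix.smul_mul, upperEntries_smul, RingHom.id_apply]

lemma skewAct_apply (M : Matrix (Fin 5) (Fin 5) ℂ) (v : Fin 10 → ℂ) :
    skewAct M v = upperEntries (M * skewMatrix v * Mᵀ) := rfl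

lemma skewMatrix_skewAct (M : Matrix (Fin 5) (Fin 5) ℂ) (v : Fin 10 → ℂ) :
    skewMatrix (skewAct M v) = M * skewMatrix v * Mᵀ := by
  refine skewMatrix_upperEntries_of_transpose ?_
  simp only [Matrix.transpose_mul, skewMatrix_transpose, Matrix.transpose_transpose,
    Matrix.mul_assoc, Matrix.neg_mul, Matrix.mul_neg]

lemma skewAct_mul (M N : Matrix (Fin 5) (Fin 5) ℂ) (v : Fin 10 → ℂ) :
    skewAct (M * N) v = skewAct M (skewAct N v) :=
  skewMatrix_injective <| by
    simp only [skewMatrix_skewAct, Matrix.transpose_mul, Matrix.mul_assoc]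

lemma skewAct_one (v : Fin 10 → ℂ) : skewAct 1 v = v :=
  skewMatrix_injective <| by simp [skewMatrix_skewAct]

/-- The isometries of the form `splitForm`. -/
def IsSplitIsometry (M : Matrix (Fin 5) (Fin 5) ℂ) : Prop :=
  Mᵀ * splitForm ℂ * M = splitForm ℂ

lemma IsSplitIsometry.mul {M N : Matrix (Fin 5) (Fin 5) ℂ} (hM : IsSplitIsometry M)
    (hN : IsSplitIsometry N) : IsSplitIsometry (M * N) := by
  have h : (M * N)ᵀ * splitForm ℂ * (M * N) = Nᵀ * (Mᵀ * splitForm ℂ * M) * N := by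
    simp only [Matrix.transpose_mul, Matrix.mul_assoc]
  rw [IsSplitIsometry, h, hM, hN]

lemma IsSplitIsometry.mul_inverse {M : Matrix (Fin 5) (Fin 5) ℂ} (hM : IsSplitIsometry M) :
    M * (splitForm ℂ * Mᵀ * splitForm ℂ) = 1 := by
  rw [mul_eq_one_comm]
  have h : splitForm ℂ * Mᵀ * splitForm ℂ * M = splitForm ℂ * (Mᵀ * splitForm ℂ * M) := by
    simp only [Matrix.mul_assoc]
  rw [h, hM, splitForm_mul_self]

lemma IsSplitIsometry.splitBracket_skewAct {M : Matrix (Fin 5) (Fin 5) ℂ}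
    (hM : IsSplitIsometry M) (v w : Fin 10 → ℂ) :
    splitBracket (skewAct M v) (skewAct M w) = skewAct M (splitBracket v w) := by
  apply skewMatrix_injective
  have h (Y Z : Matrix (Fin 5) (Fin 5) ℂ) :
      M * Y * Mᵀ * splitForm ℂ * (M * Z * Mᵀ) = M * (Y * splitForm ℂ * Z) * Mᵀ := by
    have h1 : M * Y * Mᵀ * splitForm ℂ * (M * Z * Mᵀ) =
        M * Y * (Mᵀ * splitForm ℂ * M) * Z * Mᵀ := by simp only [Matrix.mul_assoc]
    rw [h1, hM]
    simp only [Matrix.mul_assoc]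
  simp only [skewMatrix_splitBracket, skewMatrix_skewAct, h, Matrix.mul_sub, Matrix.sub_mul]

lemma IsSplitIsometry.skewAct_ne_zero {M : Matrix (Fin 5) (Fin 5) ℂ} (hM : IsSplitIsometry M)
    {v : Fin 10 → ℂ} (hv : v ≠ 0) : skewAct M v ≠ 0 := by
  intro h
  apply hv
  rw [← skewAct_one v, ← mul_eq_one_comm.1 hM.mul_inverse, skewAct_mul, h, map_zero]

theorem KoszulBound.skewAct {M : Matrix (Fin 5) (Fin 5) ℂ} (hM : IsSplitIsometry M)
    {x y : Fin 10 → ℂ} (h : KoszulBound splitTensor x y) :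
    KoszulBound splitTensor (skewAct M x) (skewAct M y) :=
  KoszulBound.map_automorphism (B := splitBracketLinear)
    (g' := _root_.skewAct (splitForm ℂ * Mᵀ * splitForm ℂ))
    (fun v => by rw [← skewAct_mul, hM.mul_inverse, skewAct_one])
    hM.splitBracket_skewAct h

/-- The isometry that swaps the coordinates `0` and `1`, and dually `4` and `3`. -/
def planeSwap : Matrix (Fin 5) (Fin 5) ℂ :=
  !![0, 1, 0, 0, 0; 1, 0, 0, 0, 0; 0, 0, 1, 0, 0; 0, 0, 0, 0, 1; 0, 0, 0, 1, 0]

/-- The isometry that swaps the coordinates `0` and `4`. -/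
def dualSwap : Matrix (Fin 5) (Fin 5) ℂ :=
  !![0, 0, 0, 0, 1; 0, 1, 0, 0, 0; 0, 0, 1, 0, 0; 0, 0, 0, 1, 0; 1, 0, 0, 0, 0]

/-- The root subgroup of the short root of `e_1`. -/
noncomputable def shortUnipotent (s : ℂ) : Matrix (Fin 5) (Fin 5) ℂ :=
  !![1, 0, s, 0, -(s ^ 2 / 2); 0, 1, 0, 0, 0; 0, 0, 1, 0, -s; 0, 0, 0, 1, 0; 0, 0, 0, 0, 1]

/-- A one-parameter torus of isometries. Its weights on `e_0` and `e_1` are `3` and `2`, those on the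
other coordinates are at most `1`. -/
noncomputable def splitTorus (r : ℂ) : Matrix (Fin 5) (Fin 5) ℂ :=
  Matrix.diagonal ![r ^ 2, r, 1, r⁻¹, r⁻¹ ^ 2]

lemma isSplitIsometry_planeSwap : IsSplitIsometry planeSwap := by
  ext i j
  fin_cases i <;> fin_cases j <;> simp [planeSwap, splitForm, Matrix.mul_apply, Fin.sum_univ_five]

lemma isSplitIsometry_dualSwap : IsSplitIsometry dualSwap := by
  ext i j
  fin_cases i <;> fin_cases j <;> simp [dualSwap, splitForm, Matrix.mul_apply, Fin.sum_univ_five]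

lemma isSplitIsometry_shortUnipotent (s : ℂ) : IsSplitIsometry (shortUnipotent s) := by
  ext i j
  fin_cases i <;> fin_cases j <;>
    simp [shortUnipotent, splitForm, Matrix.mul_apply, Fin.sum_univ_five]
  ring

lemma isSplitIsometry_splitTorus {r : ℂ} (hr : r ≠ 0) : IsSplitIsometry (splitTorus r) := by
  ext i j
  fin_cases i <;> fin_cases j <;>
    simp [splitTorus, splitForm, Matrix.mul_apply, Fin.sum_univ_five, hr]

lemma skewAct_planeSwap (v : Fin 10 → ℂ) : skewAct planeSwap v =
    ![-v 0, v 4, v 6, v 5, v 1, v 3, v 2, v 8, v 7, -v 9] := by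
  ext i
  fin_cases i <;> simp [skewAct_apply, upperEntries, skewMatrix, planeSwap, Matrix.mul_apply,
    Fin.sum_univ_five]

lemma skewAct_dualSwap (v : Fin 10 → ℂ) : skewAct dualSwap v =
    ![-v 6, -v 8, -v 9, -v 3, v 4, v 5, -v 0, v 7, -v 1, -v 2] := by
  ext i
  fin_cases i <;> simp [skewAct_apply, upperEntries, skewMatrix, dualSwap, Matrix.mul_apply,
    Fin.sum_univ_five]

lemma skewAct_shortUnipotent (s : ℂ) (v : Fin 10 → ℂ) : skewAct (shortUnipotent s) v =
    ![v 0 - s * v 4 + s ^ 2 / 2 * v 6, v 1 - s * v 3 - s ^ 2 / 2 * v 8,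
      v 2 + s * v 7 + s ^ 2 / 2 * v 9, v 3 + s * v 8, v 4 - s * v 6, v 5, v 6, v 7 + s * v 9,
      v 8, v 9] := by
  ext i
  fin_cases i <;> simp [skewAct_apply, upperEntries, skewMatrix, shortUnipotent, Matrix.mul_apply,
    Fin.sum_univ_five] <;> ring

/-- The torus, rescaled so that it extends to `r = 0`: the exponent at `e_p` is the difference of the
weights of the highest root vector `e_0` and of `e_p`. -/
def degenerate (r : ℂ) (v : Fin 10 → ℂ) : Fin 10 → ℂ :=
  fun i => r ^ (![0, 1, 2, 3, 2, 3, 4, 4, 5, 6] i : ℕ) * v i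

lemma degenerate_eq_smul_skewAct {r : ℂ} (hr : r ≠ 0) (v : Fin 10 → ℂ) :
    degenerate r v = r ^ 3 • skewAct (splitTorus r⁻¹) v := by
  ext i
  fin_cases i <;> simp [degenerate, skewAct_apply, upperEntries, skewMatrix, splitTorus] <;>
    field_simp <;> simp

lemma KoszulBound.degenerate {r : ℂ} (hr : r ≠ 0) {x y : Fin 10 → ℂ} {c : ℂ} (hc : c ≠ 0)
    (h : KoszulBound splitTensor x y) :
    KoszulBound splitTensor (degenerate r x) (c • degenerate r y) := by
  have h3 : r ^ 3 ≠ 0 := pow_ne_zero 3 hr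
  refine (h.skewAct (isSplitIsometry_splitTorus (inv_ne_zero hr))).of_mem_span ?_ ?_
  · rw [degenerate_eq_smul_skewAct hr, Submodule.mem_span_pair]
    exact ⟨(r ^ 3)⁻¹, 0, by rw [inv_smul_smul₀ h3, zero_smul, add_zero]⟩
  · rw [degenerate_eq_smul_skewAct hr y, Submodule.mem_span_pair]
    exact ⟨0, (r ^ 3)⁻¹ * c⁻¹, by
      rw [zero_smul, zero_add, ← smul_smul, inv_smul_smul₀ hc, inv_smul_smul₀ h3]⟩

/-- Every orbit in the orthogonal Lie algebra spans it, so some isometry moves `x ≠ 0` to a vector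
with nonzero highest root coordinate. -/
theorem exists_skewAct_apply_zero_ne_zero {x : Fin 10 → ℂ} (hx : x ≠ 0) :
    ∃ M, IsSplitIsometry M ∧ skewAct M x 0 ≠ 0 := by
  by_contra! h
  -- The vectors without such an isometry form a stable set; all their coordinates vanish, one
  -- after the other.
  let Q : (Fin 10 → ℂ) → Prop := fun v => ∀ M, IsSplitIsometry M → skewAct M v 0 = 0
  have hQ {v : Fin 10 → ℂ} (hv : Q v) {N : Matrix (Fin 5) (Fin 5) ℂ} (hN : IsSplitIsometry N) :
      Q (skewAct N v) := fun M hM => by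
    rw [← skewAct_mul]; exact hv _ (hM.mul hN)
  have hp {v : Fin 10 → ℂ} (hv : Q v) := hQ hv isSplitIsometry_planeSwap
  have hd {v : Fin 10 → ℂ} (hv : Q v) := hQ hv isSplitIsometry_dualSwap
  have hu {v : Fin 10 → ℂ} (hv : Q v) := hQ hv (isSplitIsometry_shortUnipotent 1)
  have h0 {v : Fin 10 → ℂ} (hv : Q v) : v 0 = 0 := by
    have := hv 1 (by simp [IsSplitIsometry])
    rwa [skewAct_one] at this
  have h6 {v : Fin 10 → ℂ} (hv : Q v) : v 6 = 0 := by
    simpa [skewAct_dualSwap] using h0 (hd hv)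
  have h2 {v : Fin 10 → ℂ} (hv : Q v) : v 2 = 0 := by
    simpa [skewAct_planeSwap] using h6 (hp hv)
  have h9 {v : Fin 10 → ℂ} (hv : Q v) : v 9 = 0 := by
    simpa [skewAct_dualSwap] using h2 (hd hv)
  have h4 {v : Fin 10 → ℂ} (hv : Q v) : v 4 = 0 := by
    simpa [skewAct_shortUnipotent, h0 hv, h6 hv] using h0 (hu hv)
  have h1 {v : Fin 10 → ℂ} (hv : Q v) : v 1 = 0 := by
    simpa [skewAct_planeSwap] using h4 (hp hv)
  have h8 {v : Fin 10 → ℂ} (hv : Q v) : v 8 = 0 := by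
    simpa [skewAct_dualSwap] using h1 (hd hv)
  have h7 {v : Fin 10 → ℂ} (hv : Q v) : v 7 = 0 := by
    simpa [skewAct_planeSwap] using h8 (hp hv)
  have h3 {v : Fin 10 → ℂ} (hv : Q v) : v 3 = 0 := by
    simpa [skewAct_shortUnipotent, h1 hv, h8 hv] using h1 (hu hv)
  have h5 {v : Fin 10 → ℂ} (hv : Q v) : v 5 = 0 := by
    simpa [skewAct_planeSwap] using h3 (hp hv)
  apply hx
  ext i
  fin_cases i
  exacts [h0 h, h1 h, h2 h, h3 h, h4 h, h5 h, h6 h, h7 h, h8 h, h9 h]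

/-- Some isometry that preserves the line of the highest root vector `e_0` moves a given `y`
outside this line to a vector with nonzero coordinate at the second highest root vector `e_1`. -/
theorem exists_skewAct_apply_one_ne_zero {y : Fin 10 → ℂ} (hy : y ≠ 0) (hy0 : y 0 = 0) :
    ∃ M, IsSplitIsometry M ∧ (∃ c : ℂ, c ≠ 0 ∧ skewAct M (Pi.single 0 1) = c • Pi.single 0 1) ∧
      skewAct M y 1 ≠ 0 := by
  by_contra! h
  let Q : (Fin 10 → ℂ) → Prop := fun v => ∀ M, IsSplitIsometry M →
    (∃ c : ℂ, c ≠ 0 ∧ skewAct M (Pi.single 0 1) = c • Pi.single 0 1) → skewAct M v 1 = 0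
  have hQ {v : Fin 10 → ℂ} (hv : Q v) {N : Matrix (Fin 5) (Fin 5) ℂ} (hN : IsSplitIsometry N)
      (hN' : ∃ c : ℂ, c ≠ 0 ∧ skewAct N (Pi.single 0 1) = c • Pi.single 0 1) :
      Q (skewAct N v) := fun M hM ⟨c, hc, hc'⟩ => by
    obtain ⟨d, hd, hd'⟩ := hN'
    rw [← skewAct_mul]
    refine hv _ (hM.mul hN) ⟨d * c, mul_ne_zero hd hc, ?_⟩
    rw [skewAct_mul, hd', map_smul, hc', smul_smul]
  have hp {v : Fin 10 → ℂ} (hv : Q v) := hQ hv isSplitIsometry_planeSwap ⟨-1, by norm_num, by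
    rw [skewAct_planeSwap]; ext i; fin_cases i <;> simp⟩
  have hu {v : Fin 10 → ℂ} (hv : Q v) (s : ℂ) := hQ hv (isSplitIsometry_shortUnipotent s)
    ⟨1, one_ne_zero, by rw [skewAct_shortUnipotent]; ext i; fin_cases i <;> simp⟩
  have h1 {v : Fin 10 → ℂ} (hv : Q v) : v 1 = 0 := by
    have := hv 1 (by simp [IsSplitIsometry]) ⟨1, one_ne_zero, by rw [skewAct_one, one_smul]⟩
    rwa [skewAct_one] at this
  have h4 {v : Fin 10 → ℂ} (hv : Q v) : v 4 = 0 := by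
    simpa [skewAct_planeSwap] using h1 (hp hv)
  have h38 {v : Fin 10 → ℂ} (hv : Q v) : v 3 = 0 ∧ v 8 = 0 := by
    have e1 := h1 (hu hv 1)
    have e2 := h1 (hu hv (-1))
    simp only [skewAct_shortUnipotent, h1 hv, Matrix.cons_val_one, Matrix.cons_val_zero] at e1 e2
    constructor
    · linear_combination (-1 / 2) * e1 + (1 / 2) * e2
    · linear_combination -e1 - e2
  have h5 {v : Fin 10 → ℂ} (hv : Q v) : v 5 = 0 := by
    simpa [skewAct_planeSwap] using (h38 (hp hv)).1
  have h7 {v : Fin 10 → ℂ} (hv : Q v) : v 7 = 0 := by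
    simpa [skewAct_planeSwap] using (h38 (hp hv)).2
  have h6 {v : Fin 10 → ℂ} (hv : Q v) : v 6 = 0 := by
    simpa [skewAct_shortUnipotent, h4 hv] using h4 (hu hv 1)
  have h2 {v : Fin 10 → ℂ} (hv : Q v) : v 2 = 0 := by
    simpa [skewAct_planeSwap] using h6 (hp hv)
  have h9 {v : Fin 10 → ℂ} (hv : Q v) : v 9 = 0 := by
    simpa [skewAct_shortUnipotent, h2 hv, h7 hv] using h2 (hu hv 1)
  apply hy
  ext i
  fin_cases i
  exacts [hy0, h1 h, h2 h, (h38 h).1, h4 h, h5 h, h6 h, h7 h, (h38 h).2, h9 h]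

/-! ### Degeneration to the two highest root vectors -/

lemma continuous_degenerate (v : Fin 10 → ℂ) : Continuous fun r => degenerate r v := by
  unfold degenerate
  fun_prop

lemma degenerate_zero (v : Fin 10 → ℂ) : degenerate 0 v = Pi.single 0 (v 0) := by
  ext i
  fin_cases i <;> simp [degenerate]

lemma degenerate_single_zero (r : ℂ) : degenerate r (Pi.single 0 1) = Pi.single 0 1 := by
  ext i
  fin_cases i <;> simp [degenerate]

lemma degenerate_ne_zero {r : ℂ} (hr : r ≠ 0) {v : Fin 10 → ℂ} (hv : v ≠ 0) :
    degenerate r v ≠ 0 := by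
  rw [degenerate_eq_smul_skewAct hr]
  exact smul_ne_zero (pow_ne_zero 3 hr)
    ((isSplitIsometry_splitTorus (inv_ne_zero hr)).skewAct_ne_zero hv)

lemma tendsto_inv_smul_degenerate {v : Fin 10 → ℂ} (hv : v 0 = 0) {r : ℕ → ℂ}
    (hr : Tendsto r atTop (𝓝 0)) (hr0 : ∀ n, r n ≠ 0) :
    Tendsto (fun n => (r n)⁻¹ • degenerate (r n) v) atTop (𝓝 (Pi.single 1 (v 1))) := by
  let E : ℂ → Fin 10 → ℂ := fun r i => r ^ (![0, 0, 1, 2, 1, 2, 3, 3, 4, 5] i : ℕ) * v i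
  have hE : Continuous E := by fun_prop
  have hE0 : E 0 = Pi.single 1 (v 1) := by
    ext i
    fin_cases i <;> simp [E, hv]
  have h : (fun n => (r n)⁻¹ • degenerate (r n) v) = fun n => E (r n) := by
    funext n
    have := hr0 n
    ext i
    fin_cases i <;> simp [E, degenerate, hv] <;> field_simp
  rw [h, ← hE0]
  exact (hE.tendsto 0).comp hr

/-- Subtracting a multiple of the first vector does not change the plane. -/
lemma KoszulBound.sub_smul {t : Fin 10 → Fin 10 → Fin 10 → ℂ} {x y : Fin 10 → ℂ}
    (h : KoszulBound t x y) {a b : ℂ} (ha : a ≠ 0) (hb : b ≠ 0) (c : ℂ) :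
    KoszulBound t (a • x) (b • (y - c • x)) := by
  refine h.of_mem_span ?_ ?_ <;> rw [Submodule.mem_span_pair]
  · exact ⟨a⁻¹, 0, by rw [inv_smul_smul₀ ha, zero_smul, add_zero]⟩
  · exact ⟨c * a⁻¹, b⁻¹, by
      rw [← smul_smul, inv_smul_smul₀ ha, inv_smul_smul₀ hb, add_sub_cancel]⟩

/-- If `KoszulBound` held for some plane, then degenerating this plane under the orthogonal group
to the plane spanned by the two highest root vectors would give a contradiction. -/
theorem false_of_koszulBound {x y : Fin 10 → ℂ} {k : Fin 10} (hx : x k ≠ 0) (hyk : y k = 0)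
    (hy : y ≠ 0) (h : KoszulBound splitTensor x y) : False := by
  let r : ℕ → ℂ := fun n => ((1 / ((n : ℝ) + 1) : ℝ) : ℂ)
  have hr : Tendsto r atTop (𝓝 0) := by
    have := (Complex.continuous_ofReal.tendsto 0).comp
      (tendsto_one_div_add_atTop_nhds_zero_nat (𝕜 := ℝ))
    rwa [Complex.ofReal_zero] at this
  have hr0 (n : ℕ) : r n ≠ 0 := Complex.ofReal_ne_zero.2 (by positivity)
  -- The first vector degenerates to the highest root vector.
  obtain ⟨y', hy', hy'0, h'⟩ : ∃ y' : Fin 10 → ℂ, y' ≠ 0 ∧ y' 0 = 0 ∧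
      KoszulBound splitTensor (Pi.single 0 1) y' := by
    obtain ⟨M, hM, hMx⟩ := exists_skewAct_apply_zero_ne_zero
      (x := x) fun h0 => hx (by rw [h0, Pi.zero_apply])
    set c : ℂ := skewAct M y 0 / skewAct M x 0 with hc
    set x₁ : Fin 10 → ℂ := (skewAct M x 0)⁻¹ • skewAct M x with hx₁
    set y₁ : Fin 10 → ℂ := (1 : ℂ) • (skewAct M y - c • skewAct M x) with hy₁
    have h₁ : KoszulBound splitTensor x₁ y₁ :=
      (h.skewAct hM).sub_smul (inv_ne_zero hMx) one_ne_zero c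
    have hx₁0 : x₁ 0 = 1 := by simp [hx₁, hMx]
    have hy₁0 : y₁ 0 = 0 := by simp [hy₁, hc, hMx]
    have hy₁ne : y₁ ≠ 0 := by
      rw [hy₁, one_smul, ← map_smul, ← map_sub]
      refine hM.skewAct_ne_zero fun h0 => hy ?_
      have hc0 : c = 0 := by
        have := congrFun h0 k
        simpa [hyk, hx] using this
      simpa [hc0] using h0
    have hne (n : ℕ) : ‖degenerate (r n) y₁‖ ≠ 0 :=
      norm_ne_zero_iff.2 (degenerate_ne_zero (hr0 n) hy₁ne)
    obtain ⟨y', hy', σ, hσ, hlim⟩ := (isCompact_sphere (0 : Fin 10 → ℂ) 1).tendsto_subseq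
      (x := fun n => ((‖degenerate (r n) y₁‖⁻¹ : ℝ) : ℂ) • degenerate (r n) y₁) fun n => by
        rw [mem_sphere_zero_iff_norm, norm_smul, Complex.norm_real, norm_inv, norm_norm,
          inv_mul_cancel₀ (hne n)]
    have hy'1 : y' ≠ 0 := by
      rintro rfl
      simp at hy'
    have hy'0 : y' 0 = 0 := by
      refine tendsto_nhds_unique (tendsto_pi_nhds.1 hlim 0) ?_
      simp [degenerate, hy₁0]
    obtain ⟨m, hm⟩ := Function.ne_iff.1 hy'1
    refine ⟨y', hy'1, hy'0, koszulBound_of_tendsto (f := atTop) (t := fun _ => splitTensor)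
      (x := fun n => degenerate (r (σ n)) x₁) (k := 0) (m := m) tendsto_const_nhds ?_ hlim ?_ ?_⟩
    · have := ((continuous_degenerate x₁).tendsto 0).comp (hr.comp hσ.tendsto_atTop)
      rwa [degenerate_zero, hx₁0] at this
    · simpa [hy'0] using hm
    · exact Eventually.of_forall fun n => h₁.degenerate (hr0 _)
        (Complex.ofReal_ne_zero.2 (inv_ne_zero (hne _)))
  -- The second vector degenerates to the second highest root vector.
  obtain ⟨M, hM, ⟨c, hc, hMc⟩, hM1⟩ := exists_skewAct_apply_one_ne_zero hy' hy'0
  have h₂ := h'.skewAct hM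
  rw [hMc] at h₂
  set z : Fin 10 → ℂ := skewAct M y' with hz
  set y₂ : Fin 10 → ℂ := (z 1)⁻¹ • (z - (z 0 / c) • c • Pi.single 0 1) with hy₂
  have h₃ : KoszulBound splitTensor (c⁻¹ • c • Pi.single 0 1) y₂ :=
    h₂.sub_smul (inv_ne_zero hc) (inv_ne_zero hM1) _
  rw [inv_smul_smul₀ hc] at h₃
  have hy₂0 : y₂ 0 = 0 := by simp [hy₂, div_mul_cancel₀ _ hc]
  have hy₂1 : y₂ 1 = 1 := by simp [hy₂, hM1]
  refine not_koszulBound_splitTensor (koszulBound_of_tendsto (f := atTop)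
    (t := fun _ => splitTensor) (x := fun _ => Pi.single 0 1)
    (y := fun n => (r n)⁻¹ • degenerate (r n) y₂) (k := 0) (m := 1) tendsto_const_nhds
    tendsto_const_nhds ?_ ?_ ?_)
  · have := tendsto_inv_smul_degenerate hy₂0 hr hr0
    rwa [hy₂1] at this
  · simp
  · refine Eventually.of_forall fun n => ?_
    have := h₃.degenerate (hr0 n) (inv_ne_zero (hr0 n))
    rwa [degenerate_single_zero] at this

lemma exists_unit_vector (c : Fin 10 → ℂ) : ∃ x : Fin 10 → ℂ, ‖x‖ = 1 ∧ ∃ a : ℂ, c = a • x := by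
  by_cases hc : c = 0
  · exact ⟨Pi.single 0 1, by rw [Pi.norm_single, norm_one], 0, by rw [hc, zero_smul]⟩
  · have hc' : ‖c‖ ≠ 0 := norm_ne_zero_iff.2 hc
    refine ⟨((‖c‖⁻¹ : ℝ) : ℂ) • c, ?_, ‖c‖, ?_⟩
    · rw [norm_smul, Complex.norm_real, norm_inv, norm_norm, inv_mul_cancel₀ hc']
    · rw [smul_smul, ← Complex.ofReal_mul, mul_inv_cancel₀ hc', Complex.ofReal_one, one_smul]

/-- Modulo `x`, every vector is a multiple of a unit vector whose coordinate `k` is zero. Limits of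
such unit vectors stay linearly independent of limits of `x`. -/
lemma exists_unit_vector_apply_eq_zero (k : Fin 10) {x c : Fin 10 → ℂ} (hx : x k ≠ 0) :
    ∃ y : Fin 10 → ℂ, ‖y‖ = 1 ∧ y k = 0 ∧ c ∈ Submodule.span ℂ {x, y} := by
  set d : Fin 10 → ℂ := c - (c k / x k) • x with hd
  have hdk : d k = 0 := by simp [hd, div_mul_cancel₀ _ hx]
  have hc (a : ℂ) (y : Fin 10 → ℂ) (h : d = a • y) : c ∈ Submodule.span ℂ {x, y} :=
    Submodule.mem_span_pair.2 ⟨c k / x k, a, by rw [← h, hd]; module⟩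
  by_cases h0 : d = 0
  · obtain ⟨k', hk'⟩ := exists_ne k
    exact ⟨Pi.single k' 1, by rw [Pi.norm_single, norm_one], by simp [hk'.symm],
      hc 0 _ (by rw [h0, zero_smul])⟩
  · obtain ⟨y, hy, a, ha⟩ := exists_unit_vector d
    have ha0 : a ≠ 0 := by
      rintro rfl
      exact h0 (by rw [ha, zero_smul])
    refine ⟨y, hy, ?_, hc a y ha⟩
    rw [ha] at hdk
    simpa [ha0] using hdk

/-- The tensor of the orthogonal Lie algebra in split coordinates is not a limit of sums of
eighteen rank-one tensors. -/
theorem false_of_tendsto_splitTensor (a b c : ℕ → Fin 18 → Fin 10 → ℂ)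
    (h : Tendsto (fun n j l => ∑ s, (a n s j * b n s l) • c n s) atTop (𝓝 splitTensor)) :
    False := by
  choose x hx u hu using fun n => exists_unit_vector (c n 0)
  obtain ⟨x₀, hx₀, σ, hσ, hlim⟩ := (isCompact_sphere (0 : Fin 10 → ℂ) 1).tendsto_subseq
    (x := x) fun n => mem_sphere_zero_iff_norm.2 (hx n)
  have hx₀' : x₀ ≠ 0 := by
    rintro rfl
    simp at hx₀
  obtain ⟨k, hk⟩ := Function.ne_iff.1 hx₀'
  have hy (n : ℕ) : ∃ y : Fin 10 → ℂ, ‖y‖ = 1 ∧ y k = 0 ∧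
      (x (σ n) k ≠ 0 → c (σ n) 1 ∈ Submodule.span ℂ {x (σ n), y}) := by
    by_cases hxk : x (σ n) k = 0
    · obtain ⟨y, h1, h2, -⟩ := exists_unit_vector_apply_eq_zero k (c := 0) hk
      exact ⟨y, h1, h2, fun h => absurd hxk h⟩
    · obtain ⟨y, h1, h2, h3⟩ := exists_unit_vector_apply_eq_zero k (c := c (σ n) 1) hxk
      exact ⟨y, h1, h2, fun _ => h3⟩
  choose y hy1 hyk hyc using hy
  obtain ⟨y₀, hy₀, ρ, hρ, hlim'⟩ := (isCompact_sphere (0 : Fin 10 → ℂ) 1).tendsto_subseq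
    (x := y) fun n => mem_sphere_zero_iff_norm.2 (hy1 n)
  have hy₀' : y₀ ≠ 0 := by
    rintro rfl
    simp at hy₀
  have hy₀k : y₀ k = 0 := by
    refine tendsto_nhds_unique (tendsto_pi_nhds.1 hlim' k) ?_
    simp [hyk]
  obtain ⟨m, hm⟩ := Function.ne_iff.1 hy₀'
  have hlim₂ := hlim.comp hρ.tendsto_atTop
  refine false_of_koszulBound hk hy₀k hy₀' (koszulBound_of_tendsto (f := atTop)
    (t := fun n j l => ∑ s, (a (σ (ρ n)) s j * b (σ (ρ n)) s l) • c (σ (ρ n)) s)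
    (x := fun n => x (σ (ρ n))) (y := fun n => y (ρ n)) (k := k) (m := m)
    (h.comp (hσ.tendsto_atTop.comp hρ.tendsto_atTop)) hlim₂ hlim' ?_ ?_)
  · simpa [hy₀k] using ⟨hk, hm⟩
  · filter_upwards [(tendsto_pi_nhds.1 hlim₂ k).eventually_ne hk] with n hn
    refine (koszulBound_of_sum _ _ _).of_mem_span ?_ (hyc _ hn)
    exact Submodule.mem_span_pair.2 ⟨u (σ (ρ n)), 0, by rw [zero_smul, add_zero, ← hu]⟩

/-! ### Structure tensor, rank and border rank -/

/-- A matrix whose columns are a basis of `ℂ⁵` in which the standard quadratic form is given by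
`splitForm`. -/
noncomputable def splitBasis : Matrix (Fin 5) (Fin 5) ℂ :=
  !![1 / 2, 0, 0, 0, 1; Complex.I / 2, 0, 0, 0, -Complex.I; 0, 1 / 2, 0, 1, 0;
    0, Complex.I / 2, 0, -Complex.I, 0; 0, 0, 1, 0, 0]

lemma splitBasis_transpose_mul : splitBasisᵀ * splitBasis = splitForm ℂ := by
  have h := Complex.I_mul_I
  ext i j
  fin_cases i <;> fin_cases j <;>
    simp [splitBasis, splitForm, Matrix.mul_apply, Fin.sum_univ_five] <;>
    first | linear_combination h / 4 | linear_combination -h / 2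

lemma splitBasis_mul_form_mul : splitBasis * (splitForm ℂ * splitBasisᵀ) = 1 := by
  rw [mul_eq_one_comm, Matrix.mul_assoc, splitBasis_transpose_mul, splitForm_mul_self]

lemma form_mul_splitBasis_mul : splitForm ℂ * splitBasisᵀ * splitBasis = 1 :=
  mul_eq_one_comm.1 splitBasis_mul_form_mul

/-- The split coordinates on the orthogonal Lie algebra. -/
noncomputable def splitCoords : LieAlgebra.Orthogonal.so (Fin 5) ℂ ≃ₗ[ℂ] (Fin 10 → ℂ) :=
  LinearEquiv.symm
  { toFun v := ⟨splitBasis * skewMatrix v * splitBasisᵀ, by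
      rw [LieAlgebra.Orthogonal.mem_so]
      simp only [Matrix.transpose_mul, skewMatrix_transpose, Matrix.transpose_transpose,
        Matrix.mul_assoc, Matrix.neg_mul, Matrix.mul_neg]⟩
    map_add' v w := Subtype.ext <| by
      simp only [skewMatrix_add, Matrix.mul_add, Matrix.add_mul]; rfl
    map_smul' c v := Subtype.ext <| by
      simp only [skewMatrix_smul, Matrix.mul_smul, Matrix.smul_mul]; rfl
    invFun X := upperEntries (splitForm ℂ * splitBasisᵀ * X.1 * (splitBasis * splitForm ℂ))
    left_inv v := by
      have h : splitForm ℂ * splitBasisᵀ * (splitBasis * skewMatrix v * splitBasisᵀ) *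
          (splitBasis * splitForm ℂ) = (splitForm ℂ * splitBasisᵀ * splitBasis) * skewMatrix v *
            ((splitBasisᵀ * splitBasis) * splitForm ℂ) := by simp only [Matrix.mul_assoc]
      simp only [h, form_mul_splitBasis_mul, splitBasis_transpose_mul, splitForm_mul_self,
        Matrix.one_mul, Matrix.mul_one, upperEntries_skewMatrix]
    right_inv X := by
      have hX : (X.1)ᵀ = -X.1 := (LieAlgebra.Orthogonal.mem_so _ _ _).1 X.2
      have h1 : splitBasis * splitForm ℂ * splitBasisᵀ = 1 := by
        rw [Matrix.mul_assoc, splitBasis_mul_form_mul]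
      apply Subtype.ext
      simp only
      rw [skewMatrix_upperEntries_of_transpose]
      · have h : splitBasis * (splitForm ℂ * splitBasisᵀ * X.1 * (splitBasis * splitForm ℂ)) *
            splitBasisᵀ = (splitBasis * splitForm ℂ * splitBasisᵀ) * X.1 *
              (splitBasis * splitForm ℂ * splitBasisᵀ) := by simp only [Matrix.mul_assoc]
        rw [h, h1, Matrix.one_mul, Matrix.mul_one]
      · simp only [Matrix.transpose_mul, Matrix.transpose_transpose, splitForm_transpose, hX,
          Matrix.mul_assoc, Matrix.neg_mul, Matrix.mul_neg] }

lemma coe_splitCoords_symm (v : Fin 10 → ℂ) :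
    (splitCoords.symm v : Matrix (Fin 5) (Fin 5) ℂ) = splitBasis * skewMatrix v * splitBasisᵀ :=
  rfl

lemma lie_splitCoords_symm (v w : Fin 10 → ℂ) :
    ⁅splitCoords.symm v, splitCoords.symm w⁆ = splitCoords.symm (splitBracket v w) := by
  apply Subtype.ext
  have h (X Y : LieAlgebra.Orthogonal.so (Fin 5) ℂ) : (⁅X, Y⁆ : LieAlgebra.Orthogonal.so _ ℂ).1 =
      X.1 * Y.1 - Y.1 * X.1 := rfl
  rw [h, coe_splitCoords_symm, coe_splitCoords_symm,
    coe_splitCoords_symm, skewMatrix_splitBracket, ← splitBasis_transpose_mul]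
  simp only [Matrix.mul_assoc, Matrix.mul_sub, Matrix.sub_mul]

/-- The basis of the orthogonal Lie algebra that belongs to the split coordinates. -/
noncomputable def splitLieBasis : Basis (Fin 10) ℂ (LieAlgebra.Orthogonal.so (Fin 5) ℂ) :=
  Basis.ofEquivFun splitCoords

section Coordinates

variable {L : Type*} [AddCommGroup L] [Module ℂ L] {ι : Type*}

/-- The coordinates of a tensor in `L* ⊗ L* ⊗ L` with respect to a basis of `L`. -/
noncomputable def tensorCoords (b : Basis ι ℂ L) :
    Dual ℂ L ⊗[ℂ] (Dual ℂ L ⊗[ℂ] L) →ₗ[ℂ] (ι → ι → ι → ℂ) :=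
  LinearMap.pi fun j => LinearMap.pi fun l => LinearMap.pi fun k =>
    LinearMap.mul' ℂ ℂ ∘ₗ TensorProduct.map (Dual.eval ℂ L (b j))
      (LinearMap.mul' ℂ ℂ ∘ₗ TensorProduct.map (Dual.eval ℂ L (b l)) (b.coord k))

lemma tensorCoords_tmul (b : Basis ι ℂ L) (α β : Dual ℂ L) (X : L) (j l k : ι) :
    tensorCoords b (α ⊗ₜ (β ⊗ₜ X)) j l k = α (b j) * (β (b l) * b.repr X k) := by
  simp [tensorCoords]

lemma IsTensorLimit.tendsto_tensorCoords [Finite ι] (b : Basis ι ℂ L)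
    {S : ℝ → Dual ℂ L ⊗[ℂ] (Dual ℂ L ⊗[ℂ] L)} {T : Dual ℂ L ⊗[ℂ] (Dual ℂ L ⊗[ℂ] L)}
    (h : IsTensorLimit S T) :
    Tendsto (fun ε => tensorCoords b (S ε)) (𝓝[>] 0) (𝓝 (tensorCoords b T)) := by
  let : TopologicalSpace (Dual ℂ L ⊗[ℂ] (Dual ℂ L ⊗[ℂ] L)) := moduleTopology ℂ _
  have : IsModuleTopology ℂ (Dual ℂ L ⊗[ℂ] (Dual ℂ L ⊗[ℂ] L)) := ⟨rfl⟩
  have hc : Continuous (tensorCoords b) :=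
    IsModuleTopology.continuous_of_linearMap (tensorCoords b)
  exact (hc.tendsto T).comp h

end Coordinates

lemma tensorCoords_structureTensor :
    tensorCoords splitLieBasis (structureTensor (LieAlgebra.Orthogonal.so (Fin 5) ℂ)) =
      splitTensor := by
  have hb (j : Fin 10) : splitLieBasis j = splitCoords.symm (Pi.single j 1) := by
    simp [splitLieBasis]
  funext j l k
  rw [structureTensor_eq_sum _ splitLieBasis]
  simp only [map_sum, map_smul, Finset.sum_apply, Pi.smul_apply, tensorCoords_tmul]
  simp only [Basis.coord_apply, Basis.repr_self, Finsupp.single_apply, smul_eq_mul, mul_ite,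
    mul_one, mul_zero, Finset.sum_ite_eq, Finset.sum_ite_eq',
    Finset.mem_univ, if_true]
  rw [hb, hb, lie_splitCoords_symm]
  simp [splitLieBasis, splitTensor, bilinTensor, splitBracketLinear]

section Rank

variable {A B C : Type*} [AddCommGroup A] [Module ℂ A] [AddCommGroup B] [Module ℂ B]
  [AddCommGroup C] [Module ℂ C]

/-- Every tensor is a sum of rank-one tensors, so the infimum in `tensorRank` is attained. -/
lemma exists_eq_sum_tensorRank (T : A ⊗[ℂ] (B ⊗[ℂ] C)) :
    ∃ (a : Fin (tensorRank T) → A) (b : Fin (tensorRank T) → B) (c : Fin (tensorRank T) → C),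
      T = ∑ i, a i ⊗ₜ[ℂ] (b i ⊗ₜ[ℂ] c i) := by
  have hadd {S T : A ⊗[ℂ] (B ⊗[ℂ] C)}
      (hS : ∃ (r : ℕ) (a : Fin r → A) (b : Fin r → B) (c : Fin r → C),
        S = ∑ i, a i ⊗ₜ[ℂ] (b i ⊗ₜ[ℂ] c i))
      (hT : ∃ (r : ℕ) (a : Fin r → A) (b : Fin r → B) (c : Fin r → C),
        T = ∑ i, a i ⊗ₜ[ℂ] (b i ⊗ₜ[ℂ] c i)) :
      ∃ (r : ℕ) (a : Fin r → A) (b : Fin r → B) (c : Fin r → C),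
        S + T = ∑ i, a i ⊗ₜ[ℂ] (b i ⊗ₜ[ℂ] c i) := by
    obtain ⟨r, a, b, c, rfl⟩ := hS
    obtain ⟨r', a', b', c', rfl⟩ := hT
    exact ⟨r + r', Fin.append a a', Fin.append b b', Fin.append c c', by simp [Fin.sum_univ_add]⟩
  refine Nat.sInf_mem (s := {r : ℕ | ∃ (a : Fin r → A) (b : Fin r → B) (c : Fin r → C),
    T = ∑ i, a i ⊗ₜ[ℂ] (b i ⊗ₜ[ℂ] c i)}) ?_
  induction T using TensorProduct.induction_on with
  | zero => exact ⟨0, Fin.elim0, Fin.elim0, Fin.elim0, by simp⟩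
  | add S T hS hT => exact hadd hS hT
  | tmul x y =>
    induction y using TensorProduct.induction_on with
    | zero => exact ⟨0, Fin.elim0, Fin.elim0, Fin.elim0, by simp⟩
    | add y z hy hz => rw [TensorProduct.tmul_add]; exact hadd hy hz
    | tmul y z => exact ⟨1, fun _ => x, fun _ => y, fun _ => z, by simp⟩

/-- A decomposition into at most `n` rank-one terms can be padded by zeros to `n` terms. -/
lemma exists_eq_sum_of_tensorRank_le {T : A ⊗[ℂ] (B ⊗[ℂ] C)} {n : ℕ} (h : tensorRank T ≤ n) :
    ∃ (a : Fin n → A) (b : Fin n → B) (c : Fin n → C), T = ∑ i, a i ⊗ₜ[ℂ] (b i ⊗ₜ[ℂ] c i) := by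
  obtain ⟨a, b, c, hT⟩ := exists_eq_sum_tensorRank T
  obtain ⟨d, rfl⟩ := Nat.exists_eq_add_of_le h
  exact ⟨Fin.append a 0, Fin.append b 0, Fin.append c 0, by
    conv_lhs => rw [hT]
    simp [Fin.sum_univ_add]⟩

end Rank

theorem theorem5 :
    19 ≤ borderRank (structureTensor (LieAlgebra.Orthogonal.so (Fin 5) ℂ)) := by
  set T := structureTensor (LieAlgebra.Orthogonal.so (Fin 5) ℂ) with hT
  -- The set of admissible ranks is nonempty, as it contains the rank of `T` itself.
  obtain ⟨S, hS, hlim⟩ := Nat.sInf_mem (s := {r : ℕ | ∃ S : ℝ → _,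
    (∀ ε : ℝ, 0 < ε → tensorRank (S ε) = r) ∧ IsTensorLimit S T})
    ⟨tensorRank T, fun _ => T, fun _ _ => rfl, by
      let : TopologicalSpace (Dual ℂ (LieAlgebra.Orthogonal.so (Fin 5) ℂ) ⊗[ℂ]
        (Dual ℂ (LieAlgebra.Orthogonal.so (Fin 5) ℂ) ⊗[ℂ] LieAlgebra.Orthogonal.so (Fin 5) ℂ)) :=
        moduleTopology ℂ _
      exact tendsto_const_nhds⟩
  change ∀ ε : ℝ, 0 < ε → tensorRank (S ε) = borderRank T at hS
  by_contra! h
  let ε : ℕ → ℝ := fun n => 1 / ((n : ℝ) + 1)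
  have hε (n : ℕ) : 0 < ε n := by positivity
  have hε0 : Tendsto ε atTop (𝓝[>] 0) :=
    tendsto_nhdsWithin_iff.2 ⟨tendsto_one_div_add_atTop_nhds_zero_nat, Eventually.of_forall hε⟩
  choose a b c habc using fun n => exists_eq_sum_of_tensorRank_le (T := S (ε n)) (n := 18)
    (by rw [hS _ (hε n)]; omega)
  refine false_of_tendsto_splitTensor (fun n s j => a n s (splitLieBasis j))
    (fun n s l => b n s (splitLieBasis l)) (fun n s k => splitLieBasis.repr (c n s) k) ?_
  have h1 := (hlim.tendsto_tensorCoords splitLieBasis).comp hε0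
  rw [hT, tensorCoords_structureTensor] at h1
  convert h1 using 1
  funext n j l k
  simp only [Function.comp_apply, habc, map_sum, Finset.sum_apply, tensorCoords_tmul,
    Pi.smul_apply, smul_eq_mul, mul_assoc]
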